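/- Let $m$ denote Lebesgue measure on $\mathbb{R}_+=(0,\infty)$, and also the direct sum measure on the disjoint union $\mathbb{R}_+\oplus\mathbb{R}_+$ of two copies of $(0,\infty)$. For a real measurable function $f$ on a measure space $(\Omega,\nu)$ let $\mu(t;f)=\inf\{s\ge 0:\nu(\{|f|>s\})\le t\}$ be its decreasing rearrangement. For real $f,g\in L_1(\Omega,\nu)$ write $f\prec\prec g$ if $\int_0^t\mu(s;f)\,ds\le\int_0^t\mu(s;g)\,ds$ for all $t\ge 0$, and write $f\prec g$ if $f_+\prec\prec g_+$, $f_-\prec\prec g_-$ and $\int f\,d\nu=\int g\,d\nu$, where $f_\pm=\max(\pm f,0)$. Let $x,y\in L_1(0,\infty)$ be real functions with $x\prec y$. Then there exist two sequences $\{A_n\}_{n\ge0}$ and $\{B_n\}_{n\ge0}$ of measurable subsets of $\mathbb{R}_+\oplus\mathbb{R}_+$, each consisting of pairwise disjoint sets, such that $\bigcup_n A_n=\bigcup_n B_n=\mathbb{R}_+\oplus\mathbb{R}_+$ and, for every $n\ge 0$, $m(A_n)=m(B_n)<\infty$ and $(x\oplus 0)\chi_{B_n}\prec (y\oplus 0)\chi_{A_n}$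 on $\mathbb{R}_+\oplus\mathbb{R}_+$, where $x\oplus 0$ equals $x$ on the first copy of $\mathbb{R}_+$ and $0$ on the second. -/

import Mathlib

open MeasureTheory
open scoped ENNReal

namespace HLP

/-- The half-line `(0, ∞)`. -/
abbrev HalfLine : Type := Set.Ioi (0 : ℝ)

/-- Lebesgue measure on `(0, ∞)`. -/
noncomputable def halfLineMeasure : Measure HalfLine :=
  Measure.comap Subtype.val (volume : Measure ℝ)

section Majorization

variable {α : Type*} [MeasurableSpace α]

/-- The decreasing rearrangement of `|x|` (generalized singular value function) at `t`,
`inf {s ≥ 0 : ν {|x| > s} ≤ t}`, with values in `[0, ∞]` (so that `inf ∅ = ∞`). -/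
noncomputable def rearrangement (ν : Measure α) (x : α → ℝ) (t : ℝ) : ℝ≥0∞ :=
  sInf {s : ℝ≥0∞ | ν {a | s < ENNReal.ofReal |x a|} ≤ ENNReal.ofReal t}

/-- Hardy-Littlewood-Pólya submajorization `x ≺≺ y`. -/
def Submajorized (ν : Measure α) (x y : α → ℝ) : Prop :=
  ∀ t : ℝ, 0 ≤ t →
    ∫⁻ s in Set.Ioo 0 t, rearrangement ν x s ≤ ∫⁻ s in Set.Ioo 0 t, rearrangement ν y s

/-- Hardy-Littlewood-Pólya majorization `x ≺ y` of real integrable functions on a measure space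
(possibly of infinite measure): `x₊ ≺≺ y₊`, `x₋ ≺≺ y₋` and `∫ x = ∫ y`. -/
structure Majorized (ν : Measure α) (x y : α → ℝ) : Prop where
  integrable_left : Integrable x ν
  integrable_right : Integrable y ν
  pos : Submajorized ν (fun a => max (x a) 0) (fun a => max (y a) 0)
  neg : Submajorized ν (fun a => max (-x a) 0) (fun a => max (-y a) 0)
  integral_eq : ∫ a, x a ∂ν = ∫ a, y a ∂ν

end Majorization

/-- The direct sum `m ⊕ m` of two copies of Lebesgue measure, on the disjoint union
`(0, ∞) ⊕ (0, ∞)`. -/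
noncomputable def sumMeasure : Measure (HalfLine ⊕ HalfLine) :=
  Measure.map Sum.inl halfLineMeasure + Measure.map Sum.inr halfLineMeasure

/-- The function `x ⊕ 0` on `(0, ∞) ⊕ (0, ∞)`: `x` on the first copy, `0` on the second. -/
def extendZero (x : HalfLine → ℝ) : HalfLine ⊕ HalfLine → ℝ :=
  Sum.elim x (fun _ => 0)

end HLP

namespace HLP

open Set Filter Topology

/-! The sets are first built on one copy of the half-line, with no relation between their measures;
the second copy is only ballast that equalizes the measures at the end.

Let `x`, `y` be nonnegative with `x ≺≺ y`. This says that the largest integral of `x` over sets of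
measure at most `t` does not exceed that of `y` (`dom_iff_submajorized`), and the largest integrals
are attained on superlevel sets `X t`, `Y t` of measure exactly `t`. The core, `exists_goodPair`,
splits off sets `B`, `A` of finite measure with `∫_B x = ∫_A y > 0` and `x` on `B` dominated by `y`
on `A`, such that domination persists between the complements. If `X s` and `Y s` carry equal mass
for some `s > 0`, they serve. Otherwise `B` is a thin layer of `x` with values in `[α, β]`, and `A`
combines a layer where `y ≥ β` with a layer where `y ≤ α`, in the proportion that matches the
integrals. For the values of `t` at which this removal could do harm, compactness gives the strict
inequality a positive margin. Families of such pairs are stable under increasing countable unions,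
so an exhaustion uses up the whole mass of `x` (`exists_goodFamily_exhausting`).

Applied to positive and negative parts, this leaves remainders of `y₊` and `y₋`, of equal mass
because `∫ x = ∫ y`. Both are cut into pieces of matching masses (`exists_cut_pair`); a positive and
a negative piece together form a set over which `y` integrates to zero, and it is paired with the
empty set. Elsewhere both functions vanish almost everywhere, and any pieces of finite measure do
(`exists_majorized_partition`). -/

/-! ### Lebesgue measure on the half-line and its initial pieces -/

lemma halfLineMeasure_apply (S : Set HalfLine) :
    halfLineMeasure S = volume (Subtype.val '' S) :=
  (MeasurableEmbedding.subtype_coe measurableSet_Ioi).comap_apply _ _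

lemma halfLineMeasure_singleton (a : HalfLine) : halfLineMeasure {a} = 0 := by
  rw [halfLineMeasure_apply]; simp

/-- The points of the half-line below `q`. -/
def below (q : ℝ) : Set HalfLine := {a | a.1 < q}

lemma measurableSet_below (q : ℝ) : MeasurableSet (below q) :=
  measurableSet_lt measurable_subtype_coe measurable_const

lemma isLowerSet_below (q : ℝ) : IsLowerSet (below q) :=
  fun _ b hba ha => lt_of_le_of_lt (show b.1 ≤ _ from hba) ha

lemma below_mono : Monotone below := fun _ _ h _ ha => lt_of_lt_of_le ha h

lemma iUnion_below : ⋃ n : ℕ, below n = univ := by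
  ext a
  simpa [below] using exists_nat_gt a.1

lemma halfLineMeasure_below (q : ℝ) : halfLineMeasure (below q) = ENNReal.ofReal q := by
  have : Subtype.val '' below q = Ioo 0 q := by
    ext t
    simp only [below, Set.mem_image, mem_ofPred_eq, Subtype.exists, mem_Ioi, mem_Ioo]
    exact ⟨fun ⟨a, h0, h1, h2⟩ => h2 ▸ ⟨h0, h1⟩, fun ⟨h0, h1⟩ => ⟨t, h0, h1, rfl⟩⟩
  rw [halfLineMeasure_apply, this, Real.volume_Ioo, sub_zero]

lemma halfLineMeasure_univ : halfLineMeasure univ = ∞ := by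
  rw [halfLineMeasure_apply, image_univ, Subtype.range_coe, Real.volume_Ioi]

instance : SigmaFinite halfLineMeasure :=
  (⟨⟨fun n : ℕ => below n, fun _ => trivial,
    fun n => by rw [halfLineMeasure_below]; exact ENNReal.ofReal_lt_top, iUnion_below⟩⟩ :
    SigmaFinite halfLineMeasure)

/-- An atomless measure on the half-line takes every value below its total mass on some
initial interval. -/
lemma exists_measure_below_eq (ν : Measure HalfLine) (hatom : ∀ a, ν {a} = 0)
    (hfin : ∀ q, ν (below q) ≠ ∞) {c : ℝ≥0∞} (hc : c < ν univ) :
    ∃ q, ν (below q) = c := by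
  have hmono : Monotone fun q => ν (below q) := fun _ _ h => measure_mono (below_mono h)
  have hzero : below 0 = ∅ := by
    ext a; simpa [below] using le_of_lt a.2
  obtain ⟨n, hn⟩ : ∃ n : ℕ, c < ν (below n) := by
    rw [← iUnion_below, Monotone.measure_iUnion
      (fun m n h => below_mono (Nat.cast_le.2 h))] at hc
    exact lt_iSup_iff.1 hc
  set S : Set ℝ := {q | ν (below q) ≤ c}
  have hne : S.Nonempty := ⟨0, by simp [S, hzero]⟩
  have hbdd : BddAbove S := ⟨n, fun q hq => by
    by_contra h
    exact absurd (hmono (not_le.1 h).le) (not_le.2 (lt_of_le_of_lt hq hn))⟩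
  obtain ⟨u, hu0, hu, hu'⟩ := exists_seq_strictAnti_tendsto (0 : ℝ)
  refine ⟨sSup S, le_antisymm ?_ ?_⟩
  · have : below (sSup S) = ⋃ n, below (sSup S - u n) := by
      ext a
      simp only [below, mem_ofPred_eq, mem_iUnion]
      constructor
      · intro ha
        obtain ⟨k, hk⟩ := (hu'.eventually (gt_mem_nhds (sub_pos.2 ha))).exists
        exact ⟨k, by linarith⟩
      · rintro ⟨k, hk⟩
        linarith [hu k]
    have hm : Monotone fun n => below (sSup S - u n) := by
      intro i j hij
      refine below_mono ?_
      have : u j ≤ u i := by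
        exact hu0.antitone hij
      linarith
    rw [this, hm.measure_iUnion]
    refine iSup_le fun k => ?_
    obtain ⟨q, hq, hq'⟩ := exists_lt_of_lt_csSup hne (show sSup S - u k < sSup S by linarith [hu k])
    exact (hmono hq'.le).trans hq
  · have hsub : (⋂ n, below (sSup S + u n)) ⊆ below (sSup S) ∪ {a | a.1 = sSup S} := by
      intro a ha
      simp only [below, mem_iInter, mem_ofPred_eq] at ha
      have : a.1 ≤ sSup S := by
        refine ge_of_tendsto (f := fun n => sSup S + u n) (x := atTop) ?_
          (Eventually.of_forall fun n => (ha n).le)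
        simpa using tendsto_const_nhds.add hu'
      exact this.lt_or_eq
    have hm : Antitone fun n => below (sSup S + u n) := by
      intro i j hij
      refine below_mono ?_
      have : u j ≤ u i := by
        exact hu0.antitone hij
      linarith
    have h1 : c ≤ ν (⋂ n, below (sSup S + u n)) := by
      rw [hm.measure_iInter (fun k => (measurableSet_below _).nullMeasurableSet) ⟨0, hfin _⟩]
      refine le_iInf fun k => ?_
      have : sSup S + u k ∉ S := fun h => by
        have := le_csSup hbdd h
        linarith [hu k]
      exact (not_le.1 this).le
    have h2 : ν {a : HalfLine | a.1 = sSup S} = 0 := by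
      by_cases h : 0 < sSup S
      · have : {a : HalfLine | a.1 = sSup S} = {⟨sSup S, h⟩} := by
          ext a; simp [Subtype.ext_iff]
        rw [this, hatom]
      · have : {a : HalfLine | a.1 = sSup S} = ∅ := by
          ext a
          simp only [mem_ofPred_eq, mem_empty_iff_false, iff_false]
          intro h'
          exact h (h' ▸ a.2)
        rw [this, measure_empty]
    calc c ≤ _ := h1
      _ ≤ _ := measure_mono hsub
      _ ≤ _ := measure_union_le _ _
      _ = _ := by rw [h2, add_zero]

/-- Inside a measurable set of measure at least `c` there is an initial piece of measure `c`. -/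
lemma exists_lowerSet_inter_measure_eq {S : Set HalfLine}
    {c : ℝ≥0∞} (hc : c ≤ halfLineMeasure S) :
    ∃ L, MeasurableSet L ∧ IsLowerSet L ∧ halfLineMeasure (L ∩ S) = c := by
  rcases hc.eq_or_lt with rfl | hc
  · exact ⟨univ, MeasurableSet.univ, isLowerSet_univ, by simp⟩
  · obtain ⟨q, hq⟩ := exists_measure_below_eq (halfLineMeasure.restrict S) (c := c)
      (fun a => le_antisymm ((Measure.restrict_apply_le _ _).trans
        (halfLineMeasure_singleton a).le) bot_le)
      (fun q => ne_top_of_le_ne_top (by rw [halfLineMeasure_below]; exact ENNReal.ofReal_ne_top)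
        (Measure.restrict_apply_le _ _)) (by simpa using hc)
    refine ⟨below q, measurableSet_below q, isLowerSet_below q, ?_⟩
    rwa [Measure.restrict_apply (measurableSet_below q)] at hq

/-! ### Superlevel sets of prescribed measure -/

/-- A family of superlevel sets of `f`, parametrized by their measure. -/
structure LevelFamily (f : HalfLine → ℝ) (E : ℝ → Set HalfLine) : Prop where
  meas : ∀ t, MeasurableSet (E t)
  mono : Monotone E
  measure_eq : ∀ t, halfLineMeasure (E t) = ENNReal.ofReal t
  upper : ∀ t, ∀ a ∈ E t, ∀ b ∉ E t, f b ≤ f a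

lemma measure_superlevel_lt_top {f : HalfLine → ℝ} (hf : Integrable f halfLineMeasure)
    {r : ℝ} (hr : 0 < r) : halfLineMeasure {a | r ≤ f a} < ∞ :=
  hf.measure_ge_lt_top hr

/-- The level is the infimum of those at which the distribution function is at most `t`; Markov's
inequality shows that there are some. The two bounds are continuity of the measure from below and
from above. -/
lemma exists_level {f : HalfLine → ℝ} (hm : Measurable f) (h0 : ∀ a, 0 ≤ f a)
    (hf : Integrable f halfLineMeasure) {t : ℝ} (ht : 0 < t) :
    ∃ r, 0 ≤ r ∧ halfLineMeasure {a | r < f a} ≤ ENNReal.ofReal t ∧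
      ENNReal.ofReal t ≤ halfLineMeasure {a | r ≤ f a} := by
  set D : ℝ → ℝ≥0∞ := fun r => halfLineMeasure {a | r < f a} with hD
  have hanti : Antitone D := fun r s h => measure_mono fun a ha => lt_of_le_of_lt h ha
  set S : Set ℝ := {r | 0 ≤ r ∧ D r ≤ ENNReal.ofReal t}
  have hne : S.Nonempty := by
    have hint : ∫⁻ a, ENNReal.ofReal (f a) ∂halfLineMeasure < ∞ := hf.lintegral_lt_top
    set I := ∫⁻ a, ENNReal.ofReal (f a) ∂halfLineMeasure
    have hpos : 0 < I.toReal / t + 1 := by positivity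
    refine ⟨I.toReal / t + 1, hpos.le, ?_⟩
    have := meas_ge_le_lintegral_div (μ := halfLineMeasure) (f := fun a => ENNReal.ofReal (f a))
      (hm.ennreal_ofReal.aemeasurable) (ε := ENNReal.ofReal (I.toReal / t + 1)) (by simpa using hpos)
      ENNReal.ofReal_ne_top
    calc D _ ≤ _ := measure_mono fun a ha => ENNReal.ofReal_le_ofReal (le_of_lt ha)
      _ ≤ _ := this
      _ ≤ ENNReal.ofReal t := by
        refine ENNReal.div_le_of_le_mul ?_
        rw [← ENNReal.ofReal_mul ht.le]
        refine (ENNReal.ofReal_toReal hint.ne).symm.le.trans (ENNReal.ofReal_le_ofReal ?_)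
        field_simp
        linarith
  have hbdd : BddBelow S := ⟨0, fun r hr => hr.1⟩
  have hr0 : 0 ≤ sInf S := le_csInf hne fun r hr => hr.1
  obtain ⟨u, hu0, hu, hu'⟩ := exists_seq_strictAnti_tendsto (0 : ℝ)
  refine ⟨sInf S, hr0, ?_, ?_⟩
  · have : {a | sInf S < f a} = ⋃ n, {a | sInf S + u n < f a} := by
      ext a
      simp only [mem_ofPred_eq, mem_iUnion]
      constructor
      · intro ha
        obtain ⟨k, hk⟩ := (hu'.eventually (gt_mem_nhds (sub_pos.2 ha))).exists
        exact ⟨k, by linarith⟩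
      · rintro ⟨k, hk⟩
        linarith [hu k]
    have hmo : Monotone fun n => {a | sInf S + u n < f a} := by
      intro i j hij a ha
      have := hu0.antitone hij
      simp only [mem_ofPred_eq] at ha ⊢
      linarith
    rw [this, hmo.measure_iUnion]
    refine iSup_le fun k => ?_
    obtain ⟨q, hq, hq'⟩ := exists_lt_of_csInf_lt hne (show sInf S < sInf S + u k by linarith [hu k])
    exact (hanti hq'.le).trans hq.2
  · rcases hr0.eq_or_lt with h | h
    · rw [← h]
      have : {a | 0 ≤ f a} = univ := by ext a; simp [h0]
      rw [this, halfLineMeasure_univ]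
      exact le_top
    -- The truncation at half the infimum keeps the levels positive, so that the sets have finite
    -- measure and continuity from above applies.
    · have : {a | sInf S ≤ f a} = ⋂ n, {a | max (sInf S - u n) (sInf S / 2) < f a} := by
        ext a
        simp only [mem_ofPred_eq, mem_iInter]
        constructor
        · intro ha n
          have := hu n
          exact max_lt (by linarith) (by linarith)
        · intro ha
          refine le_of_tendsto (f := fun n => sInf S - u n) (x := atTop) ?_
            (Eventually.of_forall fun n => ((le_max_left _ _).trans_lt (ha n)).le)
          simpa using tendsto_const_nhds.sub hu'
      have hmo : Antitone fun n => {a | max (sInf S - u n) (sInf S / 2) < f a} := by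
        intro i j hij a ha
        have := hu0.antitone hij
        simp only [mem_ofPred_eq] at ha ⊢
        exact lt_of_le_of_lt (max_le_max (by linarith) le_rfl) ha
      rw [this, hmo.measure_iInter
        (fun k => (measurableSet_lt measurable_const hm).nullMeasurableSet) ⟨0, ?_⟩]
      · refine le_iInf fun k => ?_
        have hlt : max (sInf S - u k) (sInf S / 2) < sInf S :=
          max_lt (by linarith [hu k]) (by linarith)
        have hn := notMem_of_lt_csInf hlt hbdd
        by_contra hcon
        exact hn ⟨(by positivity : (0:ℝ) ≤ sInf S / 2).trans (le_max_right _ _), (not_le.1 hcon).le⟩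
      · refine ne_top_of_le_ne_top (measure_superlevel_lt_top hf (half_pos h)).ne
          (measure_mono fun a ha => ?_)
        exact le_of_lt (lt_of_le_of_lt (le_max_right _ _) (show max _ _ < f a from ha))

/-- If `f` has a plateau at the critical level, only an initial part of the plateau is taken, of the
size needed to reach measure `t`. Lower sets of a linear order are nested, so any two of the
resulting sets are comparable, and their measures decide the direction of the inclusion. -/
lemma exists_levelFamily {f : HalfLine → ℝ} (hm : Measurable f) (h0 : ∀ a, 0 ≤ f a)
    (hf : Integrable f halfLineMeasure) : ∃ E, LevelFamily f E := by
  have key : ∀ t : ℝ, 0 < t → ∃ (r : ℝ) (L : Set HalfLine), MeasurableSet L ∧ IsLowerSet L ∧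
      halfLineMeasure ({a | r < f a} ∪ L ∩ {a | f a = r}) = ENNReal.ofReal t := by
    intro t ht
    obtain ⟨r, -, h1, h2⟩ := exists_level hm h0 hf ht
    have hsplit : {a | r ≤ f a} = {a | r < f a} ∪ {a | f a = r} := by
      ext a; simp [le_iff_lt_or_eq, eq_comm]
    have hms : MeasurableSet {a | f a = r} := measurableSet_eq_fun hm measurable_const
    have hle : ENNReal.ofReal t - halfLineMeasure {a | r < f a} ≤
        halfLineMeasure {a | f a = r} := by
      refine tsub_le_iff_left.2 (h2.trans ?_)
      rw [hsplit]
      exact measure_union_le _ _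
    obtain ⟨L, hL, hL', hLm⟩ := exists_lowerSet_inter_measure_eq hle
    refine ⟨r, L, hL, hL', ?_⟩
    rw [measure_union ?_ (hL.inter hms), hLm]
    · exact add_tsub_cancel_of_le h1
    · refine Set.disjoint_left.2 fun a ha hb => ?_
      exact absurd hb.2 (ne_of_gt ha)
  choose! r L hL hL' hE using key
  have chain : ∀ s t, 0 < s → 0 < t →
      ({a | r s < f a} ∪ L s ∩ {a | f a = r s} ⊆ {a | r t < f a} ∪ L t ∩ {a | f a = r t} ∨
      {a | r t < f a} ∪ L t ∩ {a | f a = r t} ⊆ {a | r s < f a} ∪ L s ∩ {a | f a = r s}) := by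
    intro s t hs ht
    rcases lt_trichotomy (r s) (r t) with h | h | h
    · right
      rintro a (ha | ⟨-, ha⟩) <;> left <;> simp only [mem_ofPred_eq] at ha ⊢ <;> linarith
    · rw [h]
      rcases (hL' s hs).total (hL' t ht) with h' | h'
      · left; exact union_subset_union_right _ (inter_subset_inter_left _ h')
      · right; exact union_subset_union_right _ (inter_subset_inter_left _ h')
    · left
      rintro a (ha | ⟨-, ha⟩) <;> left <;> simp only [mem_ofPred_eq] at ha ⊢ <;> linarith
  refine ⟨fun t => if 0 < t then {a | r t < f a} ∪ L t ∩ {a | f a = r t} else ∅, ?_, ?_, ?_, ?_⟩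
  · intro t
    by_cases ht : 0 < t
    · simp only [ht, if_true]
      exact (measurableSet_lt measurable_const hm).union
        ((hL t ht).inter (measurableSet_eq_fun hm measurable_const))
    · simp [ht]
  · intro s t hst
    rcases hst.eq_or_lt with rfl | hlt
    · exact le_rfl
    by_cases hs : 0 < s
    · have ht : 0 < t := hs.trans hlt
      simp only [hs, ht, if_true]
      rcases chain s t hs ht with h | h
      · exact h
      · have := measure_mono (μ := halfLineMeasure) h
        rw [hE s hs, hE t ht, ENNReal.ofReal_le_ofReal_iff hs.le] at this
        exact absurd this (not_le.2 hlt)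
    · simp [hs]
  · intro t
    by_cases ht : 0 < t
    · simp only [ht, if_true]; exact hE t ht
    · simp [ht, ENNReal.ofReal_of_nonpos (not_lt.1 ht)]
  · intro t
    by_cases ht : 0 < t
    · simp only [ht, if_true]
      intro a ha b hb
      have hb1 : f b ≤ r t := not_lt.1 fun h => hb (Or.inl h)
      rcases ha with ha | ⟨-, ha⟩ <;> simp only [mem_ofPred_eq] at ha <;> linarith
    · simp [ht]

/-! ### Nonnegative integrable functions and their masses -/

/-- Nonnegative measurable integrable functions on the half-line. -/
structure Density (f : HalfLine → ℝ) : Prop where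
  measurable : Measurable f
  nonneg : ∀ a, 0 ≤ f a
  integrable : Integrable f halfLineMeasure

/-- The integral of `f` over `E`. -/
noncomputable def mass (f : HalfLine → ℝ) (E : Set HalfLine) : ℝ :=
  ∫ a in E, f a ∂halfLineMeasure

lemma Density.indicator {f : HalfLine → ℝ} (hf : Density f) {B : Set HalfLine}
    (hB : MeasurableSet B) : Density (B.indicator f) :=
  ⟨hf.measurable.indicator hB, fun a => indicator_nonneg (fun a _ => hf.nonneg a) a,
    hf.integrable.indicator hB⟩

lemma mass_indicator {f : HalfLine → ℝ} {B : Set HalfLine}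
    (hB : MeasurableSet B) (E : Set HalfLine) : mass (B.indicator f) E = mass f (E ∩ B) :=
  setIntegral_indicator hB

@[simp] lemma mass_empty (f : HalfLine → ℝ) : mass f ∅ = 0 := by simp [mass]

namespace Density

variable {f : HalfLine → ℝ} {S T : Set HalfLine}

lemma mass_nonneg (hf : Density f) (S : Set HalfLine) : 0 ≤ mass f S :=
  integral_nonneg fun a => hf.nonneg a

lemma mass_mono (hf : Density f) (h : S ⊆ T) : mass f S ≤ mass f T :=
  setIntegral_mono_set hf.integrable.integrableOn (ae_of_all _ fun a => hf.nonneg a)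
    (LE.le.eventuallyLE h)

lemma mass_union (hf : Density f) (h : Disjoint S T) (hT : MeasurableSet T) :
    mass f (S ∪ T) = mass f S + mass f T :=
  setIntegral_union h hT hf.integrable.integrableOn hf.integrable.integrableOn

lemma mass_sdiff (hf : Density f) (hT : MeasurableSet T) (h : T ⊆ S) :
    mass f (S \ T) = mass f S - mass f T :=
  setIntegral_sdiff hT hf.integrable.integrableOn h

lemma mass_inter_add_sdiff (hf : Density f) (hT : MeasurableSet T) :
    mass f (S ∩ T) + mass f (S \ T) = mass f S :=
  integral_inter_add_sdiff hT hf.integrable.integrableOn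

lemma mass_le (hf : Density f) (hS : MeasurableSet S) {c t : ℝ} (hc : 0 ≤ c) (ht : 0 ≤ t)
    (hm : halfLineMeasure S ≤ ENNReal.ofReal t) (h : ∀ a ∈ S, f a ≤ c) : mass f S ≤ c * t := by
  have hlt : halfLineMeasure S < ∞ := hm.trans_lt ENNReal.ofReal_lt_top
  calc mass f S ≤ ∫ _ in S, c ∂halfLineMeasure :=
        setIntegral_mono_on hf.integrable.integrableOn
          (integrableOn_const hlt.ne) hS h
    _ = halfLineMeasure.real S * c := by rw [setIntegral_const, smul_eq_mul]
    _ ≤ c * t := by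
        rw [mul_comm]
        exact mul_le_mul_of_nonneg_left (ENNReal.toReal_le_of_le_ofReal ht hm) hc

lemma le_mass (hf : Density f) (hS : MeasurableSet S) {c t : ℝ} (ht : 0 ≤ t)
    (hm : halfLineMeasure S = ENNReal.ofReal t) (h : ∀ a ∈ S, c ≤ f a) : c * t ≤ mass f S := by
  have hlt : halfLineMeasure S < ∞ := hm.le.trans_lt ENNReal.ofReal_lt_top
  calc c * t = ∫ _ in S, c ∂halfLineMeasure := by
        rw [setIntegral_const, smul_eq_mul, measureReal_def, hm, ENNReal.toReal_ofReal ht, mul_comm]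
    _ ≤ mass f S :=
        setIntegral_mono_on (integrableOn_const hlt.ne) hf.integrable.integrableOn hS h

lemma ofReal_mass (hf : Density f) (S : Set HalfLine) :
    ENNReal.ofReal (mass f S) = ∫⁻ a in S, ENNReal.ofReal (f a) ∂halfLineMeasure :=
  ofReal_integral_eq_lintegral_ofReal hf.integrable.integrableOn (ae_of_all _ hf.nonneg)

lemma exists_levelFamily (hf : Density f) : ∃ E, LevelFamily f E :=
  HLP.exists_levelFamily hf.measurable hf.nonneg hf.integrable

end Density

/-! ### Rearrangements through superlevel sets -/

lemma rearrangement_antitone {α : Type*} [MeasurableSpace α] (ν : Measure α) (f : α → ℝ) :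
    Antitone (rearrangement ν f) :=
  fun _ _ h => sInf_le_sInf fun _ hr => le_trans hr (ENNReal.ofReal_le_ofReal h)

/-- The distribution function is continuous from the right, so the infimum defining the
rearrangement is attained. -/
lemma lt_rearrangement_iff {α : Type*} [MeasurableSpace α] (ν : Measure α) (f : α → ℝ)
    (s : ℝ) (r : ℝ≥0∞) :
    r < rearrangement ν f s ↔ ENNReal.ofReal s < ν {a | r < ENNReal.ofReal |f a|} := by
  rw [← not_le, ← not_le (b := ENNReal.ofReal s), not_iff_not]
  constructor
  · intro h
    set S : Set ℝ≥0∞ := {s' : ℝ≥0∞ | ν {a | s' < ENNReal.ofReal |f a|} ≤ ENNReal.ofReal s}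
    have hne : S.Nonempty := ⟨∞, by simp [S]⟩
    obtain ⟨u, hu, hu', huS⟩ := exists_seq_tendsto_sInf hne (OrderBot.bddBelow S)
    have hsub : {a | r < ENNReal.ofReal |f a|} ⊆ ⋃ n, {a | u n < ENNReal.ofReal |f a|} := by
      intro a ha
      obtain ⟨k, hk⟩ := (hu'.eventually (gt_mem_nhds (lt_of_le_of_lt h ha))).exists
      exact mem_iUnion.2 ⟨k, hk⟩
    have hmo : Monotone fun n => {a | u n < ENNReal.ofReal |f a|} :=
      fun i j hij a ha => lt_of_le_of_lt (hu hij) ha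
    refine (measure_mono hsub).trans ?_
    rw [hmo.measure_iUnion]
    exact iSup_le huS
  · exact fun h => sInf_le h

lemma rearrangement_lt_top {f : HalfLine → ℝ} (hf : Density f) {s : ℝ} (hs : 0 < s) :
    rearrangement halfLineMeasure f s < ∞ := by
  obtain ⟨r, -, h, -⟩ := exists_level hf.measurable hf.nonneg hf.integrable hs
  refine lt_of_le_of_lt (sInf_le ?_) (ENNReal.ofReal_lt_top (r := r))
  refine (measure_mono fun a ha => ?_).trans h
  have ha' : ENNReal.ofReal r < ENNReal.ofReal |f a| := ha
  rw [abs_of_nonneg (hf.nonneg a)] at ha'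
  exact lt_of_not_ge fun hle => not_le.2 ha' (ENNReal.ofReal_le_ofReal hle)

/-- Layer-cake formula: the rearrangement exceeds `r` exactly on an initial interval of length
`halfLineMeasure {a | r < f a}`, which is then truncated at `t`. -/
lemma lintegral_rearrangement {f : HalfLine → ℝ} (hf : Density f) (t : ℝ) :
    ∫⁻ s in Ioo 0 t, rearrangement halfLineMeasure f s =
      ∫⁻ r in Ioi (0 : ℝ), min (ENNReal.ofReal t) (halfLineMeasure {a | r < f a}) := by
  have h1 : ∫⁻ s in Ioo 0 t, rearrangement halfLineMeasure f s =
      ∫⁻ s in Ioo 0 t, ENNReal.ofReal (rearrangement halfLineMeasure f s).toReal :=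
    setLIntegral_congr_fun measurableSet_Ioo fun s hs =>
      (ENNReal.ofReal_toReal (rearrangement_lt_top hf hs.1).ne).symm
  rw [h1, lintegral_eq_lintegral_meas_lt _ (ae_of_all _ fun _ => ENNReal.toReal_nonneg)
    (rearrangement_antitone _ _).measurable.ennreal_toReal.aemeasurable]
  refine setLIntegral_congr_fun measurableSet_Ioi fun r hr => ?_
  have hr0 : (0 : ℝ) ≤ r := le_of_lt hr
  have hset : {a | ENNReal.ofReal r < ENNReal.ofReal |f a|} = {a | r < f a} := by
    ext a
    simp only [mem_ofPred_eq]
    rw [abs_of_nonneg (hf.nonneg a), ENNReal.ofReal_lt_ofReal_iff_of_nonneg hr0]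
  set D := halfLineMeasure {a | r < f a} with hD
  have hDtop : D ≠ ∞ := ne_top_of_le_ne_top (measure_superlevel_lt_top hf.integrable hr).ne
    (measure_mono fun a ha => le_of_lt (show r < f a from ha))
  have : {s | r < (rearrangement halfLineMeasure f s).toReal} ∩ Ioo 0 t =
      Ioo 0 (min t D.toReal) := by
    ext s
    simp only [mem_inter_iff, mem_ofPred_eq, mem_Ioo, lt_min_iff]
    constructor
    · rintro ⟨h, h0, ht⟩
      rw [← ENNReal.ofReal_lt_iff_lt_toReal hr0 (rearrangement_lt_top hf h0).ne,
        lt_rearrangement_iff, hset, ENNReal.ofReal_lt_iff_lt_toReal h0.le hDtop] at h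
      exact ⟨h0, ht, h⟩
    · rintro ⟨h0, ht, h⟩
      rw [← ENNReal.ofReal_lt_iff_lt_toReal hr0 (rearrangement_lt_top hf h0).ne,
        lt_rearrangement_iff, hset, ENNReal.ofReal_lt_iff_lt_toReal h0.le hDtop]
      exact ⟨h, h0, ht⟩
  change volume.restrict (Ioo 0 t) {s | r < (rearrangement halfLineMeasure f s).toReal} =
    min (ENNReal.ofReal t) D
  rw [Measure.restrict_apply' measurableSet_Ioo, this, Real.volume_Ioo, sub_zero]
  rw [ENNReal.ofReal_min, ENNReal.ofReal_toReal hDtop]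

lemma ofReal_mass_eq_lintegral_measure {f : HalfLine → ℝ} (hf : Density f)
    {S : Set HalfLine} (hS : MeasurableSet S) :
    ENNReal.ofReal (mass f S) =
      ∫⁻ r in Ioi (0 : ℝ), halfLineMeasure ({a | r < f a} ∩ S) := by
  rw [hf.ofReal_mass, lintegral_eq_lintegral_meas_lt _ (ae_of_all _ hf.nonneg)
    hf.measurable.aemeasurable]
  simp_rw [Measure.restrict_apply' hS]

lemma ofReal_mass_le_lintegral_rearrangement {f : HalfLine → ℝ} (hf : Density f)
    {S : Set HalfLine} (hS : MeasurableSet S) {t : ℝ}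
    (h : halfLineMeasure S ≤ ENNReal.ofReal t) :
    ENNReal.ofReal (mass f S) ≤ ∫⁻ s in Ioo 0 t, rearrangement halfLineMeasure f s := by
  rw [ofReal_mass_eq_lintegral_measure hf hS, lintegral_rearrangement hf]
  exact lintegral_mono fun r =>
    le_min ((measure_mono inter_subset_right).trans h) (measure_mono inter_subset_left)

namespace LevelFamily

variable {f : HalfLine → ℝ} {E : ℝ → Set HalfLine}

/-- For every `r`, the sets `E t` and `{a | r < f a}` are nested one way or the other, so the
measure of their intersection is the minimum in the layer-cake formula. -/
lemma lintegral_rearrangement_eq (hE : LevelFamily f E) (hf : Density f) (t : ℝ) :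
    ∫⁻ s in Ioo 0 t, rearrangement halfLineMeasure f s = ENNReal.ofReal (mass f (E t)) := by
  refine le_antisymm ?_
    (ofReal_mass_le_lintegral_rearrangement hf (hE.meas t) (hE.measure_eq t).le)
  rw [ofReal_mass_eq_lintegral_measure hf (hE.meas t), lintegral_rearrangement hf]
  refine lintegral_mono fun r => ?_
  by_cases h : ∃ a ∈ E t, f a ≤ r
  · obtain ⟨a, ha, har⟩ := h
    have : {a | r < f a} ∩ E t = {a | r < f a} := by
      refine inter_eq_left.2 fun b hb => ?_
      by_contra hcon
      exact absurd ((hE.upper t a ha b hcon).trans har) (not_le.2 hb)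
    simp only [this]
    exact min_le_right _ _
  · push Not at h
    have : {a | r < f a} ∩ E t = E t := inter_eq_right.2 h
    simp only [this, hE.measure_eq]
    exact min_le_left _ _

lemma mass_le (hE : LevelFamily f E) (hf : Density f) {S : Set HalfLine} (hS : MeasurableSet S)
    {t : ℝ} (h : halfLineMeasure S ≤ ENNReal.ofReal t) : mass f S ≤ mass f (E t) := by
  have := ofReal_mass_le_lintegral_rearrangement hf hS h
  rw [hE.lintegral_rearrangement_eq hf] at this
  exact (ENNReal.ofReal_le_ofReal_iff (hf.mass_nonneg _)).1 this

end LevelFamily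

/-! ### Submajorization as a comparison of integrals over sets -/

/-- Hardy-Littlewood-Pólya submajorization expressed by integrals over sets. -/
def Dom (x y : HalfLine → ℝ) : Prop :=
  ∀ t : ℝ, 0 ≤ t → ∀ S, MeasurableSet S → halfLineMeasure S ≤ ENNReal.ofReal t →
    ∃ T, MeasurableSet T ∧ halfLineMeasure T ≤ ENNReal.ofReal t ∧ mass x S ≤ mass y T

lemma Dom.mass_le {x y : HalfLine → ℝ} (h : Dom x y) (hy : Density y)
    {E : ℝ → Set HalfLine} (hE : LevelFamily y E) {t : ℝ} (ht : 0 ≤ t) {S : Set HalfLine}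
    (hS : MeasurableSet S) (hSt : halfLineMeasure S ≤ ENNReal.ofReal t) :
    mass x S ≤ mass y (E t) := by
  obtain ⟨T, hT, hTt, hle⟩ := h t ht S hS hSt
  exact hle.trans (hE.mass_le hy hT hTt)

/-- Level sets are optimal for both functions, so each side compares `mass x (X t)` with `mass y (Y
t)`. -/
lemma dom_iff_submajorized {x y : HalfLine → ℝ} (hx : Density x) (hy : Density y) :
    Dom x y ↔ Submajorized halfLineMeasure x y := by
  obtain ⟨X, hX⟩ := hx.exists_levelFamily
  obtain ⟨Y, hY⟩ := hy.exists_levelFamily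
  refine forall₂_congr fun t ht => ?_
  rw [hX.lintegral_rearrangement_eq hx, hY.lintegral_rearrangement_eq hy,
    ENNReal.ofReal_le_ofReal_iff (hy.mass_nonneg _)]
  constructor
  · intro h
    obtain ⟨T, hT, hTt, hle⟩ := h _ (hX.meas t) (hX.measure_eq t).le
    exact hle.trans (hY.mass_le hy hT hTt)
  · intro h S hS hSt
    exact ⟨Y t, hY.meas t, (hY.measure_eq t).le, (hX.mass_le hx hS hSt).trans h⟩

lemma mass_indicator_compl {f : HalfLine → ℝ} {B : Set HalfLine}
    (hB : MeasurableSet B) (S : Set HalfLine) : mass (Bᶜ.indicator f) S = mass f (S \ B) := by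
  rw [mass_indicator hB.compl, sdiff_eq]

namespace LevelFamily

variable {f : HalfLine → ℝ} {E : ℝ → Set HalfLine}

lemma nonempty (hE : LevelFamily f E) {t : ℝ} (ht : 0 < t) : (E t).Nonempty := by
  rw [nonempty_iff_ne_empty]
  intro h
  have := hE.measure_eq t
  rw [h, measure_empty, eq_comm, ENNReal.ofReal_eq_zero] at this
  exact absurd this (not_le.2 ht)

lemma exists_threshold (hE : LevelFamily f E) (hf : Density f) {t : ℝ} (ht : 0 < t) :
    ∃ r, 0 ≤ r ∧ (∀ a ∈ E t, r ≤ f a) ∧ ∀ b ∉ E t, f b ≤ r := by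
  have hbdd : BddBelow (f '' E t) := ⟨0, by rintro _ ⟨a, -, rfl⟩; exact hf.nonneg a⟩
  have hne := (hE.nonempty ht).image f
  refine ⟨sInf (f '' E t), le_csInf hne ?_, fun a ha => csInf_le hbdd ⟨a, ha, rfl⟩,
    fun b hb => le_csInf hne ?_⟩
  · rintro _ ⟨a, -, rfl⟩; exact hf.nonneg a
  · rintro _ ⟨a, ha, rfl⟩; exact hE.upper t a ha b hb

lemma measure_sdiff (hE : LevelFamily f E) {s t : ℝ} (hs : 0 ≤ s) (hst : s ≤ t) :
    halfLineMeasure (E t \ E s) = ENNReal.ofReal (t - s) := by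
  rw [MeasureTheory.measure_sdiff (hE.mono hst) (hE.meas s).nullMeasurableSet
    (by rw [hE.measure_eq]; exact ENNReal.ofReal_ne_top), hE.measure_eq, hE.measure_eq,
    ENNReal.ofReal_sub _ hs]

/-- If the threshold is zero, `f` vanishes off `E t`, which then carries the whole mass; otherwise
`f` is bounded below on `E t` by a positive constant. -/
lemma mass_pos (hE : LevelFamily f E) (hf : Density f) (h : 0 < mass f univ) {t : ℝ}
    (ht : 0 < t) : 0 < mass f (E t) := by
  obtain ⟨r, hr, hr1, hr2⟩ := hE.exists_threshold hf ht
  rcases hr.eq_or_lt with rfl | hr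
  · have := hf.mass_inter_add_sdiff (S := univ) (hE.meas t)
    have h0 : mass f (univ \ E t) = 0 :=
      setIntegral_eq_zero_of_forall_eq_zero fun a ha => le_antisymm (hr2 a ha.2) (hf.nonneg a)
    rw [univ_inter, h0] at this
    linarith
  · exact (mul_pos hr ht).trans_le (hf.le_mass (hE.meas t) ht.le (hE.measure_eq t) hr1)

lemma subset_of_lt_measure (hE : LevelFamily f E) {r t : ℝ}
    (h : ENNReal.ofReal t < halfLineMeasure {a | r ≤ f a}) : ∀ a ∈ E t, r ≤ f a := by
  intro a ha
  by_contra hcon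
  refine absurd (measure_mono (μ := halfLineMeasure) (t := E t) ?_)
    (not_le.2 ((hE.measure_eq t).trans_lt h))
  intro b (hb : r ≤ f b)
  by_contra hb'
  exact hcon (hb.trans (hE.upper t a ha b hb'))

lemma le_of_measure_lt (hE : LevelFamily f E) {r t : ℝ}
    (h : halfLineMeasure {a | r < f a} < ENNReal.ofReal t) : ∀ b ∉ E t, f b ≤ r := by
  intro b hb
  by_contra hcon
  refine absurd (measure_mono (μ := halfLineMeasure) (s := E t) ?_)
    (not_le.2 (h.trans_eq (hE.measure_eq t).symm))
  intro a ha
  exact (not_le.1 hcon).trans_le (hE.upper t a ha b hb)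

/-- Off `E a` the function is at most the threshold `r` of `E a`, so the mass is `r`-Lipschitz from
`a` on. An unbounded `f` has no such bound near `0`. -/
lemma continuousOn_mass (hE : LevelFamily f E) (hf : Density f) {a : ℝ} (ha : 0 < a) :
    ContinuousOn (fun t => mass f (E t)) (Ici a) := by
  obtain ⟨r, hr, -, hr2⟩ := hE.exists_threshold hf ha
  have key : ∀ s t, a ≤ s → s ≤ t → mass f (E t) ≤ mass f (E s) + r * (t - s) := by
    intro s t has hst
    have h1 := hf.mass_sdiff (hE.meas s) (hE.mono hst)
    have h2 := hf.mass_le ((hE.meas t).diff (hE.meas s)) hr (sub_nonneg.2 hst)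
      (hE.measure_sdiff (ha.le.trans has) hst).le
      (fun b hb => hr2 b fun hb' => hb.2 (hE.mono has hb'))
    linarith
  refine (LipschitzOnWith.of_le_add_mul ⟨r, hr⟩ fun s hs t ht => ?_).continuousOn
  change mass f (E s) ≤ mass f (E t) + r * dist s t
  rcases le_total s t with h | h
  · have : 0 ≤ r * dist s t := by positivity
    linarith [hf.mass_mono (hE.mono h)]
  · rw [Real.dist_eq, abs_of_nonneg (sub_nonneg.2 h)]
    exact key t s ht h

end LevelFamily

/-! ### Splitting off one pair of sets -/

/-- A pair of sets of finite measure on which `x` is majorized by `y`. -/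
structure GoodPair (x y : HalfLine → ℝ) (A B : Set HalfLine) : Prop where
  measA : MeasurableSet A
  measB : MeasurableSet B
  finA : halfLineMeasure A < ∞
  finB : halfLineMeasure B < ∞
  mass_eq : mass y A = mass x B
  dom : Dom (B.indicator x) (A.indicator y)

/-- Removing sets of equal measure and equal integral preserves domination for large sets. -/
lemma Dom.exists_sdiff {x y : HalfLine → ℝ} (h : Dom x y) (hx : Density x) (hy : Density y)
    {Y : ℝ → Set HalfLine} (hY : LevelFamily y Y) {A B : Set HalfLine} {s t : ℝ} (hs : 0 ≤ s)
    (ht : 0 ≤ t) (hA : MeasurableSet A) (hB : MeasurableSet B)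
    (hAs : halfLineMeasure A = ENNReal.ofReal s) (hBs : halfLineMeasure B ≤ ENNReal.ofReal s)
    (hAB : mass y A = mass x B) (hAY : A ⊆ Y (t + s)) {S : Set HalfLine} (hS : MeasurableSet S)
    (hSt : halfLineMeasure S ≤ ENNReal.ofReal t) :
    ∃ T, MeasurableSet T ∧ halfLineMeasure T ≤ ENNReal.ofReal t ∧
      mass x (S \ B) ≤ mass y (T \ A) := by
  -- This set has measure `t` since `A ⊆ Y (t + s)`. Domination at `t + s` is applied to `S ∪ B`,
  -- and the common mass of `A` and `B` is subtracted.
  refine ⟨Y (t + s) \ A, (hY.meas _).diff hA, ?_, ?_⟩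
  · rw [MeasureTheory.measure_sdiff hAY hA.nullMeasurableSet
      (by rw [hAs]; exact ENNReal.ofReal_ne_top), hY.measure_eq, hAs, ← ENNReal.ofReal_sub _ hs,
      add_sub_cancel_right]
  · rw [Set.sdiff_sdiff, union_self, hy.mass_sdiff hA hAY, hAB]
    have h1 : mass x (S ∪ B) ≤ mass y (Y (t + s)) := by
      refine h.mass_le hy hY (add_nonneg ht hs) (hS.union hB) ?_
      rw [ENNReal.ofReal_add ht hs]
      exact (measure_union_le _ _).trans (add_le_add hSt hBs)
    rw [← sdiff_union_self, hx.mass_union disjoint_sdiff_left hB] at h1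
    linarith

/-- The step when the domination is an equality at some positive measure. -/
lemma exists_goodPair_of_tight {x y : HalfLine → ℝ} (h : Dom x y) (hx : Density x)
    (hy : Density y) (hpos : 0 < mass x univ) {X Y : ℝ → Set HalfLine} (hX : LevelFamily x X)
    (hY : LevelFamily y Y) {s : ℝ} (hs : 0 < s) (heq : mass y (Y s) = mass x (X s)) :
    ∃ A B, GoodPair x y A B ∧ 0 < mass x B ∧ Dom (Bᶜ.indicator x) (Aᶜ.indicator y) := by
  refine ⟨Y s, X s, ⟨hY.meas s, hX.meas s, ?_, ?_, heq, ?_⟩, hX.mass_pos hx hpos hs, ?_⟩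
  · rw [hY.measure_eq]; exact ENNReal.ofReal_lt_top
  · rw [hX.measure_eq]; exact ENNReal.ofReal_lt_top
  · intro t ht S hS hSt
    simp_rw [mass_indicator (hX.meas s), mass_indicator (hY.meas s)]
    -- Below `s` the optimal set `Y t` already lies in `Y s`; above `s` the total masses are
    -- compared.
    rcases le_total t s with hts | hst
    · refine ⟨Y t, hY.meas t, (hY.measure_eq t).le, ?_⟩
      rw [inter_eq_left.2 (hY.mono hts)]
      exact (hx.mass_mono inter_subset_left).trans (h.mass_le hy hY ht hS hSt)
    · refine ⟨Y s, hY.meas s, ?_, ?_⟩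
      · rw [hY.measure_eq]; exact ENNReal.ofReal_le_ofReal hst
      · rw [inter_self, heq]
        exact hx.mass_mono inter_subset_right
  · intro t ht S hS hSt
    simp_rw [mass_indicator_compl (hX.meas s), mass_indicator_compl (hY.meas s)]
    exact h.exists_sdiff hx hy hY hs.le ht (hY.meas s) (hX.meas s) (hY.measure_eq s)
      (hX.measure_eq s).le heq (hY.mono (by linarith)) hS hSt

/-- The step when the domination is strict at every positive measure. -/
lemma exists_goodPair_of_strict {x y : HalfLine → ℝ} (h : Dom x y) (hx : Density x)
    (hy : Density y) (hpos : 0 < mass x univ) {X Y : ℝ → Set HalfLine} (hX : LevelFamily x X)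
    (hY : LevelFamily y Y) (hlt : ∀ s, 0 < s → mass x (X s) < mass y (Y s)) :
    ∃ A B, GoodPair x y A B ∧ 0 < mass x B ∧ Dom (Bᶜ.indicator x) (Aᶜ.indicator y) := by
  -- levels of `x`
  obtain ⟨p, hp, hp2⟩ : ∃ p : ℝ, 0 < p ∧ ENNReal.ofReal (2 * p) < halfLineMeasure {a | 0 < x a} := by
    have h0 : 0 < halfLineMeasure {a | 0 < x a} := by
      rw [pos_iff_ne_zero]
      intro h0
      have : x =ᵐ[halfLineMeasure] 0 := by
        rw [Filter.EventuallyEq, ae_iff]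
        convert! h0 using 2
        ext a
        simp [(hx.nonneg a).lt_iff_ne, eq_comm]
      rw [mass, Measure.restrict_univ, integral_congr_ae this] at hpos
      simp at hpos
    obtain ⟨q, hq0, hq⟩ := ENNReal.lt_iff_exists_real_btwn.1 h0
    have hq' : 0 < q := ENNReal.ofReal_pos.1 hq.1
    exact ⟨q / 2, by positivity, by rw [mul_div_cancel₀ _ two_ne_zero]; exact hq.2⟩
  -- Between `X p` and `X (2 * p)` the values of `x` lie in `[α, β]`; `α` is positive because `X (2
  -- * p)` is too small to contain the support of `x`.
  obtain ⟨β, hβ0, hβ1, hβ2⟩ := hX.exists_threshold hx hp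
  obtain ⟨α, hα0, hα1, hα2⟩ := hX.exists_threshold hx (show 0 < 2 * p by positivity)
  have hα : 0 < α := by
    refine lt_of_le_of_ne hα0 ?_
    rintro rfl
    refine absurd (measure_mono (μ := halfLineMeasure) (s := {a | 0 < x a}) (t := X (2 * p)) ?_)
      (not_le.2 ((hX.measure_eq _).trans_lt hp2))
    intro a (ha : 0 < x a)
    by_contra hcon
    exact absurd (hα2 a hcon) (not_le.2 ha)
  -- levels of `y`
  have hyβ : 0 < halfLineMeasure {a | β ≤ y a} := by
    rw [pos_iff_ne_zero]
    intro h0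
    -- If `y < β` almost everywhere, then `mass y (Y p) ≤ β * p ≤ mass x (X p)`, against strictness
    -- at `p`.
    have h1 := hx.le_mass (hX.meas p) hp.le (hX.measure_eq p) hβ1
    have hm : MeasurableSet {a | β ≤ y a} := measurableSet_le measurable_const hy.measurable
    have h2 := hy.mass_inter_add_sdiff (S := Y p) hm
    have h3 : mass y (Y p ∩ {a | β ≤ y a}) = 0 :=
      setIntegral_measure_zero _ (measure_mono_null inter_subset_right h0)
    have h4 : mass y (Y p \ {a | β ≤ y a}) ≤ β * p := by
      refine hy.mass_le ((hY.meas p).diff hm) hβ0 hp.le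
        ((measure_mono sdiff_subset).trans (hY.measure_eq p).le) fun a ha => ?_
      exact (not_le.1 (show ¬ β ≤ y a from ha.2)).le
    linarith [hlt p hp]
  obtain ⟨t₁, ht₁, hYt₁⟩ : ∃ t : ℝ, 0 < t ∧ ∀ a ∈ Y t, β ≤ y a := by
    obtain ⟨q, hq0, hq⟩ := ENNReal.lt_iff_exists_real_btwn.1 hyβ
    exact ⟨q, ENNReal.ofReal_pos.1 hq.1, hY.subset_of_lt_measure hq.2⟩
  obtain ⟨t₂, ht₁₂, hYt₂⟩ : ∃ t : ℝ, t₁ < t ∧ ∀ b ∉ Y t, y b ≤ α := by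
    have hfin : halfLineMeasure {a | α < y a} ≠ ∞ :=
      ne_top_of_le_ne_top (measure_superlevel_lt_top hy.integrable hα).ne
        (measure_mono fun a ha => le_of_lt (show α < y a from ha))
    refine ⟨max t₁ (halfLineMeasure {a | α < y a}).toReal + 1, ?_, hY.le_of_measure_lt ?_⟩
    · linarith [le_max_left t₁ (halfLineMeasure {a | α < y a}).toReal]
    · rw [ENNReal.lt_ofReal_iff_toReal_lt hfin]
      linarith [le_max_right t₁ (halfLineMeasure {a | α < y a}).toReal]
  -- the gap
  set lo := t₁ / 2 with hlo
  have hlo0 : 0 < lo := by positivity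
  set hi := t₂ + 1 with hhi
  -- The interval must stay away from `0`, where both masses tend to zero and no margin survives.
  obtain ⟨δ, hδ, hgap⟩ : ∃ δ, 0 < δ ∧ ∀ t ∈ Icc lo hi, mass x (X t) + δ ≤ mass y (Y t) := by
    have hc : ContinuousOn (fun t => mass y (Y t) - mass x (X t)) (Icc lo hi) :=
      ((hY.continuousOn_mass hy hlo0).sub (hX.continuousOn_mass hx hlo0)).mono Icc_subset_Ici_self
    obtain ⟨t, ht, hmin⟩ := isCompact_Icc.exists_isMinOn (nonempty_Icc.2 (by linarith)) hc
    refine ⟨_, sub_pos.2 (hlt t (hlo0.trans_le ht.1)), fun u hu => ?_⟩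
    have : mass y (Y t) - mass x (X t) ≤ mass y (Y u) - mass x (X u) := hmin hu
    linarith
  -- the size of the pieces
  obtain ⟨s, hs, hslo, hsp, hs1, hsδ⟩ : ∃ s, 0 < s ∧ s ≤ lo ∧ s ≤ p ∧ s ≤ 1 ∧ β * s ≤ δ := by
    -- The bound `lo` keeps the high layer outside `Y t` for `t < lo`, the bound `p` keeps the layer
    -- of `x` inside `X (2 * p)`, and the last term keeps the removed mass within the margin `δ`.
    refine ⟨min (min lo p) (min 1 (δ / (β + 1))), by positivity, ?_, ?_, ?_, ?_⟩
    · exact (min_le_left _ _).trans (min_le_left _ _)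
    · exact (min_le_left _ _).trans (min_le_right _ _)
    · exact (min_le_right _ _).trans (min_le_left _ _)
    · have h1 : min (min lo p) (min 1 (δ / (β + 1))) ≤ δ / (β + 1) :=
        (min_le_right _ _).trans (min_le_right _ _)
      have h2 : (β + 1) * (δ / (β + 1)) = δ := by field_simp
      have h3 : 0 ≤ δ / (β + 1) := by positivity
      nlinarith [mul_le_mul_of_nonneg_left h1 hβ0]
  set B := X (p + s) \ X p with hBdef
  have hBm : MeasurableSet B := (hX.meas _).diff (hX.meas _)
  have hBs : halfLineMeasure B = ENNReal.ofReal s := by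
    rw [hX.measure_sdiff hp.le (by linarith), add_sub_cancel_left]
  have hBle : ∀ a ∈ B, x a ≤ β := fun a ha => hβ2 a ha.2
  have hBge : ∀ a ∈ B, α ≤ x a := fun a ha => hα1 a (hX.mono (by linarith) ha.1)
  have hBlo : α * s ≤ mass x B := hx.le_mass hBm hs.le hBs hBge
  have hBhi : mass x B ≤ β * s := hx.mass_le hBm hβ0 hs.le hBs.le hBle
  have hBpos : 0 < mass x B := (mul_pos hα hs).trans_le hBlo
  have up : ∀ u v, 0 ≤ u → u ≤ v → v ≤ t₁ → β * (v - u) ≤ mass y (Y v \ Y u) := by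
    intro u v hu huv hv
    exact hy.le_mass ((hY.meas _).diff (hY.meas _)) (sub_nonneg.2 huv) (hY.measure_sdiff hu huv)
      fun a ha => hYt₁ a (hY.mono hv ha.1)
  have down : ∀ u v, t₂ ≤ u → u ≤ v → mass y (Y v \ Y u) ≤ α * (v - u) := by
    intro u v hu huv
    exact hy.mass_le ((hY.meas _).diff (hY.meas _)) hα0 (sub_nonneg.2 huv)
      (hY.measure_sdiff (by linarith) huv).le fun a ha => hYt₂ a fun h' => ha.2 (hY.mono hu h')
  have hsub : ∀ u v, u ≤ v → mass y (Y v \ Y u) = mass y (Y v) - mass y (Y u) :=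
    fun u v huv => hy.mass_sdiff (hY.meas u) (hY.mono huv)
  -- Here `s₁` is the measure taken from the high layer. At `s₁ = 0` the mass is at most `α * s`, at
  -- `s₁ = s` at least `β * s`, and `mass x B` lies between; the intermediate value theorem applies.
  obtain ⟨s₁, ⟨hs₁0, hs₁s⟩, hs₁⟩ : ∃ s₁ ∈ Icc 0 s, mass y (Y t₁) - mass y (Y (t₁ - s₁)) +
      (mass y (Y (t₂ + (s - s₁))) - mass y (Y t₂)) = mass x B := by
    have hc : ContinuousOn (fun s₁ => mass y (Y t₁) - mass y (Y (t₁ - s₁)) +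
      (mass y (Y (t₂ + (s - s₁))) - mass y (Y t₂))) (Icc 0 s) := by
      have hc0 := hY.continuousOn_mass hy hlo0
      refine (continuousOn_const.sub (hc0.comp (f := fun s₁ => t₁ - s₁) (by fun_prop) ?_)).add
        ((hc0.comp (f := fun s₁ => t₂ + (s - s₁)) (by fun_prop) ?_).sub continuousOn_const)
      · intro u hu; have := hu.1; have := hu.2; change lo ≤ t₁ - u; linarith
      · intro u hu; have := hu.1; have := hu.2; change lo ≤ t₂ + (s - u); linarith
    have h0 := down t₂ (t₂ + (s - 0)) le_rfl (by linarith)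
    have h1 := up (t₁ - s) t₁ (by linarith) (by linarith) le_rfl
    rw [hsub _ _ (by linarith)] at h0 h1
    refine intermediate_value_Icc hs.le hc ⟨?_, ?_⟩
    · simp only [sub_zero, sub_self, zero_add] at h0 ⊢
      rw [add_sub_cancel_left] at h0
      linarith
    · simp only [sub_self, add_zero]
      rw [sub_sub_cancel] at h1
      linarith
  set A₁ := Y t₁ \ Y (t₁ - s₁) with hA₁
  set A₂ := Y (t₂ + (s - s₁)) \ Y t₂ with hA₂
  have hA₁m : MeasurableSet A₁ := (hY.meas _).diff (hY.meas _)
  have hA₂m : MeasurableSet A₂ := (hY.meas _).diff (hY.meas _)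
  have hdisj : ∀ S T : Set HalfLine, S ⊆ Y t₁ → T ⊆ (Y t₂)ᶜ → Disjoint S T :=
    fun S T hS hT => Set.disjoint_left.2 fun a ha ha' => hT ha' (hY.mono ht₁₂.le (hS ha))
  have hA₁₂ : Disjoint A₁ A₂ := hdisj _ _ sdiff_subset fun a ha => ha.2
  have hAm : MeasurableSet (A₁ ∪ A₂) := hA₁m.union hA₂m
  have hA₁s : halfLineMeasure A₁ = ENNReal.ofReal s₁ := by
    rw [hY.measure_sdiff (by linarith) (by linarith), sub_sub_cancel]
  have hA₂s : halfLineMeasure A₂ = ENNReal.ofReal (s - s₁) := by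
    rw [hY.measure_sdiff (by linarith) (by linarith), add_sub_cancel_left]
  have hAs : halfLineMeasure (A₁ ∪ A₂) = ENNReal.ofReal s := by
    rw [measure_union hA₁₂ hA₂m, hA₁s, hA₂s, ← ENNReal.ofReal_add hs₁0 (by linarith),
      add_sub_cancel]
  have hAmass : mass y (A₁ ∪ A₂) = mass x B := by
    rw [hy.mass_union hA₁₂ hA₂m, hsub _ _ (by linarith), hsub _ _ (by linarith), hs₁]
  refine ⟨A₁ ∪ A₂, B, ⟨hAm, hBm, ?_, ?_, hAmass, ?_⟩, hBpos, ?_⟩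
  · rw [hAs]; exact ENNReal.ofReal_lt_top
  · rw [hBs]; exact ENNReal.ofReal_lt_top
  · intro t ht S hS hSt
    simp_rw [mass_indicator hBm, mass_indicator hAm]
    have hSB : MeasurableSet (S ∩ B) := hS.inter hBm
    have hSBt : halfLineMeasure (S ∩ B) ≤ ENNReal.ofReal t :=
      (measure_mono inter_subset_left).trans hSt
    rcases le_total s t with hst | hts
    · refine ⟨A₁ ∪ A₂, hAm, hAs.le.trans (ENNReal.ofReal_le_ofReal hst), ?_⟩
      rw [inter_self, hAmass]
      exact hx.mass_mono inter_subset_right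
    -- For `t ≤ s₁` a part of the high layer of measure `t` suffices, since `y ≥ β ≥ x`. For larger
    -- `t` the parts left out are compared: `A` loses at most `α * (s - t)`, and `B \ S` carries at
    -- least that much.
    rcases le_total t s₁ with hts₁ | hs₁t
    · have hsubs : Y t₁ \ Y (t₁ - t) ⊆ A₁ ∪ A₂ := by
        refine subset_union_of_subset_left (sdiff_subset_sdiff_right (hY.mono ?_)) _
        linarith
      refine ⟨Y t₁ \ Y (t₁ - t), (hY.meas _).diff (hY.meas _), ?_, ?_⟩
      · rw [hY.measure_sdiff (by linarith) (by linarith), sub_sub_cancel]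
      · rw [inter_eq_left.2 hsubs]
        have h1 := up (t₁ - t) t₁ (by linarith) (by linarith) le_rfl
        have h2 := hx.mass_le hSB hβ0 ht hSBt fun a ha => hBle a ha.2
        rw [sub_sub_cancel] at h1
        linarith
    · have hsub₂ : Y (t₂ + (t - s₁)) ⊆ Y (t₂ + (s - s₁)) := hY.mono (by linarith)
      have hsubs : A₁ ∪ (Y (t₂ + (t - s₁)) \ Y t₂) ⊆ A₁ ∪ A₂ :=
        union_subset_union_right _ (sdiff_subset_sdiff_left hsub₂)
      have hd : Disjoint A₁ (Y (t₂ + (t - s₁)) \ Y t₂) :=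
        hA₁₂.mono_right (sdiff_subset_sdiff_left hsub₂)
      have hTm : MeasurableSet (Y (t₂ + (t - s₁)) \ Y t₂) := (hY.meas _).diff (hY.meas _)
      refine ⟨A₁ ∪ (Y (t₂ + (t - s₁)) \ Y t₂), hA₁m.union hTm, ?_, ?_⟩
      · rw [measure_union hd hTm, hA₁s, hY.measure_sdiff (by linarith) (by linarith),
          ← ENNReal.ofReal_add hs₁0 (by linarith)]
        exact ENNReal.ofReal_le_ofReal (by linarith)
      · rw [inter_eq_left.2 hsubs, hy.mass_union hd hTm, hsub _ _ (by linarith),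
          hsub _ _ (by linarith)]
        have h1 := down (t₂ + (t - s₁)) (t₂ + (s - s₁)) (by linarith) (by linarith)
        rw [hsub _ _ (by linarith)] at h1
        have h2 : α * (s - t) ≤ mass x (B \ S) := by
          have h3 : ENNReal.ofReal (s - t) ≤ halfLineMeasure (B \ S) := by
            rw [ENNReal.ofReal_sub _ ht, ← hBs]
            exact (tsub_le_tsub_left hSt _).trans le_measure_sdiff
          obtain ⟨L, hL, -, hLm⟩ := exists_lowerSet_inter_measure_eq h3
          refine (hx.le_mass (hL.inter (hBm.diff hS)) (by linarith) hLm
            fun a ha => hBge a ha.2.1).trans (hx.mass_mono inter_subset_right)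
        have h3 := hx.mass_inter_add_sdiff (S := B) hS
        rw [inter_comm] at h3
        have h4 : t₂ + (s - s₁) - (t₂ + (t - s₁)) = s - t := by ring
        rw [h4] at h1
        linarith
  · intro t ht S hS hSt
    simp_rw [mass_indicator_compl hBm, mass_indicator_compl hAm]
    have hSx : mass x (S \ B) ≤ mass x (X t) :=
      (hx.mass_mono sdiff_subset).trans (hX.mass_le hx hS hSt)
    -- Three ranges of `t`: below `lo` nothing is removed from `Y t`; on `[lo, hi]` the margin `δ`
    -- pays for the removal; beyond `hi` the set `A` lies in `Y (t + s)`.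
    rcases lt_or_ge t lo with htlo | hlot
    · refine ⟨Y t, hY.meas t, (hY.measure_eq t).le, ?_⟩
      have : Y t \ (A₁ ∪ A₂) = Y t := by
        refine Disjoint.sdiff_eq_left (Set.disjoint_left.2 ?_)
        rintro a ha (ha' | ha')
        · exact ha'.2 (hY.mono (by linarith) ha)
        · exact ha'.2 (hY.mono (by linarith) ha)
      rw [this]
      exact (hx.mass_mono sdiff_subset).trans (h.mass_le hy hY ht hS hSt)
    rcases le_total t hi with hthi | hhit
    · refine ⟨Y t, hY.meas t, (hY.measure_eq t).le, ?_⟩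
      have h1 := hgap t ⟨hlot, hthi⟩
      have h2 := hy.mass_inter_add_sdiff (S := Y t) hAm
      have h3 := hy.mass_mono (inter_subset_right (s := Y t) (t := A₁ ∪ A₂))
      linarith
    · refine h.exists_sdiff hx hy hY hs.le ht hAm hBm hAs hBs.le hAmass ?_ hS hSt
      refine union_subset (sdiff_subset.trans (hY.mono ?_)) (sdiff_subset.trans (hY.mono ?_)) <;>
        linarith

lemma exists_goodPair {x y : HalfLine → ℝ} (h : Dom x y) (hx : Density x)
    (hy : Density y) (hpos : 0 < mass x univ) :
    ∃ A B, GoodPair x y A B ∧ 0 < mass x B ∧ Dom (Bᶜ.indicator x) (Aᶜ.indicator y) := by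
  obtain ⟨X, hX⟩ := hx.exists_levelFamily
  obtain ⟨Y, hY⟩ := hy.exists_levelFamily
  by_cases hs : ∃ s, 0 < s ∧ mass y (Y s) = mass x (X s)
  · obtain ⟨s, hs, heq⟩ := hs
    exact exists_goodPair_of_tight h hx hy hpos hX hY hs heq
  · push Not at hs
    exact exists_goodPair_of_strict h hx hy hpos hX hY fun s hs0 =>
      lt_of_le_of_ne (h.mass_le hy hY hs0.le (hX.meas s) (hX.measure_eq s).le) (hs s hs0).symm

/-! ### Exhaustion by countably many pairs -/

/-- If increasing sequences are bounded, a bounded monotone real function has an element above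
which it does not increase. -/
lemma exists_forall_ge_le {α : Type*} [Preorder α] (a₀ : α) (φ : α → ℝ) (hφ : Monotone φ) (C : ℝ)
    (hC : ∀ a, φ a ≤ C) (hub : ∀ u : ℕ → α, Monotone u → ∃ b, ∀ n, u n ≤ b) :
    ∃ b, ∀ c, b ≤ c → φ c ≤ φ b := by
  have hbdd : ∀ a, BddAbove (φ '' Ici a) := fun a => ⟨C, by rintro _ ⟨c, -, rfl⟩; exact hC c⟩
  -- Each step comes within `1 / (n + 1)` of the supremum of `φ` above the current element; an upper
  -- bound of the resulting sequence leaves no room for increase.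
  have step : ∀ (n : ℕ) (a : α), ∃ b, a ≤ b ∧ ∀ c, a ≤ c → φ c < φ b + 1 / ((n : ℝ) + 1) := by
    intro n a
    have hpos : (0 : ℝ) < 1 / ((n : ℝ) + 1) := by positivity
    obtain ⟨_, ⟨b, hb, rfl⟩, hlt⟩ := exists_lt_of_lt_csSup (s := φ '' Ici a) ⟨_, a, le_rfl, rfl⟩
      (sub_lt_self _ hpos)
    refine ⟨b, hb, fun c hc => ?_⟩
    have := le_csSup (hbdd a) ⟨c, hc, rfl⟩
    linarith
  choose next hle hnext using step
  let u : ℕ → α := fun n => Nat.rec a₀ (fun k a => next k a) n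
  have hu : ∀ n, u (n + 1) = next n (u n) := fun n => rfl
  have hmono : Monotone u := monotone_nat_of_le_succ fun n => hle n (u n)
  obtain ⟨b, hb⟩ := hub u hmono
  refine ⟨b, fun c hc => le_of_forall_pos_lt_add fun ε hε => ?_⟩
  obtain ⟨n, hn⟩ := exists_nat_one_div_lt hε
  have h1 := hnext n (u n) c ((hb n).trans hc)
  have h2 := hφ (hb (n + 1))
  rw [hu] at h2
  linarith

/-- The union of the first components of a family of pairs of sets. -/
def fstUnion (F : Set (Set HalfLine × Set HalfLine)) : Set HalfLine := ⋃ p ∈ F, p.1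

/-- The union of the second components of a family of pairs of sets. -/
def sndUnion (F : Set (Set HalfLine × Set HalfLine)) : Set HalfLine := ⋃ p ∈ F, p.2

/-- Countable disjoint families of good pairs leaving remainders that are still dominated. -/
structure GoodFamily (x y : HalfLine → ℝ) (F : Set (Set HalfLine × Set HalfLine)) : Prop where
  countable : F.Countable
  good : ∀ p ∈ F, GoodPair x y p.1 p.2
  disjA : F.PairwiseDisjoint Prod.fst
  disjB : F.PairwiseDisjoint Prod.snd
  mass_eq : mass y (fstUnion F) = mass x (sndUnion F)
  dom : Dom ((sndUnion F)ᶜ.indicator x) ((fstUnion F)ᶜ.indicator y)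

section Family

variable {x y : HalfLine → ℝ} {F G : Set (Set HalfLine × Set HalfLine)}

lemma fstUnion_mono (h : F ⊆ G) : fstUnion F ⊆ fstUnion G := biUnion_subset_biUnion_left h

lemma sndUnion_mono (h : F ⊆ G) : sndUnion F ⊆ sndUnion G := biUnion_subset_biUnion_left h

lemma GoodFamily.meas_fst (h : GoodFamily x y F) : MeasurableSet (fstUnion F) :=
  MeasurableSet.biUnion h.countable fun p hp => (h.good p hp).measA

lemma GoodFamily.meas_snd (h : GoodFamily x y F) : MeasurableSet (sndUnion F) :=
  MeasurableSet.biUnion h.countable fun p hp => (h.good p hp).measB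

/-- The splitting step is applied to the remainders of `x` and `y`. Deleting the parts of the new
sets already used changes neither restricted function and makes the new sets disjoint from the old.
-/
lemma GoodFamily.extend (h : GoodFamily x y F) (hx : Density x) (hy : Density y)
    (hpos : 0 < mass x (sndUnion F)ᶜ) :
    ∃ G, GoodFamily x y G ∧ F ⊆ G ∧ mass x (sndUnion F) < mass x (sndUnion G) := by
  have hU := h.meas_fst
  have hV := h.meas_snd
  set U := fstUnion F
  set V := sndUnion F
  obtain ⟨A, B, hAB, hB0, hdom⟩ := exists_goodPair h.dom (hx.indicator hV.compl)
    (hy.indicator hU.compl) (by rwa [mass_indicator hV.compl, univ_inter])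
  rw [mass_indicator_compl hV] at hB0
  have hmass := hAB.mass_eq
  rw [mass_indicator_compl hV, mass_indicator_compl hU] at hmass
  have e1 : fstUnion (insert (A \ U, B \ V) F) = U ∪ A \ U := by
    rw [fstUnion, biUnion_insert, union_comm]; rfl
  have e2 : sndUnion (insert (A \ U, B \ V) F) = V ∪ B \ V := by
    rw [sndUnion, biUnion_insert, union_comm]; rfl
  have hAm := hAB.measA.diff hU
  have hBm := hAB.measB.diff hV
  have hmV : mass x (V ∪ B \ V) = mass x V + mass x (B \ V) :=
    hx.mass_union disjoint_sdiff_right hBm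
  have hmU : mass y (U ∪ A \ U) = mass y U + mass y (A \ U) :=
    hy.mass_union disjoint_sdiff_right hAm
  refine ⟨insert (A \ U, B \ V) F, ⟨h.countable.insert _, ?_, ?_, ?_, ?_, ?_⟩,
    subset_insert _ _, ?_⟩
  · rintro p (rfl | hp)
    · refine ⟨hAm, hBm, (measure_mono sdiff_subset).trans_lt hAB.finA,
        (measure_mono sdiff_subset).trans_lt hAB.finB, hmass, ?_⟩
      have := hAB.dom
      rwa [indicator_indicator, indicator_indicator, ← sdiff_eq, ← sdiff_eq] at this
    · exact h.good p hp
  · refine h.disjA.insert fun p hp _ => ?_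
    exact disjoint_sdiff_left.mono_right (subset_biUnion_of_mem (u := fun p => p.1) hp)
  · refine h.disjB.insert fun p hp _ => ?_
    exact disjoint_sdiff_left.mono_right (subset_biUnion_of_mem (u := fun p => p.2) hp)
  · rw [e1, e2, hmV, hmU, h.mass_eq, hmass]
  · rw [e1, e2, union_sdiff_self, union_sdiff_self, compl_union, compl_union,
      inter_comm, inter_comm Uᶜ, ← indicator_indicator, ← indicator_indicator]
    exact hdom
  · rw [e2, hmV]
    linarith

lemma Density.tendsto_mass_iUnion {f : HalfLine → ℝ} (hf : Density f) {S : ℕ → Set HalfLine}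
    (hS : ∀ n, MeasurableSet (S n)) (hmono : Monotone S) :
    Tendsto (fun n => mass f (S n)) atTop (𝓝 (mass f (⋃ n, S n))) :=
  tendsto_setIntegral_of_monotone hS hmono hf.integrable.integrableOn

/-- Only domination of the remainders needs a limit. The witness `T` depends on `n`, so it is
replaced by the optimal set `Y t` for the limiting remainder of `y`, at the cost of `mass y (U \
fstUnion (H n))`, which tends to zero. -/
lemma GoodFamily.iUnion {H : ℕ → Set (Set HalfLine × Set HalfLine)} (hx : Density x)
    (hy : Density y) (hmono : Monotone H) (h : ∀ n, GoodFamily x y (H n)) :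
    GoodFamily x y (⋃ n, H n) := by
  have e1 : fstUnion (⋃ n, H n) = ⋃ n, fstUnion (H n) := biUnion_iUnion _ _
  have e2 : sndUnion (⋃ n, H n) = ⋃ n, sndUnion (H n) := biUnion_iUnion _ _
  have hm1 : Monotone fun n => fstUnion (H n) := fun i j hij => fstUnion_mono (hmono hij)
  have hm2 : Monotone fun n => sndUnion (H n) := fun i j hij => sndUnion_mono (hmono hij)
  have ht1 := hy.tendsto_mass_iUnion (fun n => (h n).meas_fst) hm1
  have ht2 := hx.tendsto_mass_iUnion (fun n => (h n).meas_snd) hm2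
  have hdir : Directed (· ⊆ ·) H := hmono.directed_le
  refine ⟨countable_iUnion fun n => (h n).countable, ?_, ?_, ?_, ?_, ?_⟩
  · intro p hp
    obtain ⟨n, hn⟩ := mem_iUnion.1 hp
    exact (h n).good p hn
  · exact (pairwiseDisjoint_iUnion hdir).2 fun n => (h n).disjA
  · exact (pairwiseDisjoint_iUnion hdir).2 fun n => (h n).disjB
  · rw [e1, e2]
    refine tendsto_nhds_unique ht1 ?_
    simpa only [(h _).mass_eq] using ht2
  · rw [e1, e2]
    have hU : MeasurableSet (⋃ n, fstUnion (H n)) := MeasurableSet.iUnion fun n => (h n).meas_fst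
    have hV : MeasurableSet (⋃ n, sndUnion (H n)) := MeasurableSet.iUnion fun n => (h n).meas_snd
    set U := ⋃ n, fstUnion (H n)
    set V := ⋃ n, sndUnion (H n)
    have hy' := hy.indicator hU.compl
    obtain ⟨Y, hY⟩ := hy'.exists_levelFamily
    intro t ht S hS hSt
    refine ⟨Y t, hY.meas t, (hY.measure_eq t).le, ?_⟩
    have hlim : Tendsto (fun n => mass (Uᶜ.indicator y) (Y t) +
        (mass y U - mass y (fstUnion (H n)))) atTop (𝓝 (mass (Uᶜ.indicator y) (Y t) +
        (mass y U - mass y U))) := tendsto_const_nhds.add (tendsto_const_nhds.sub ht1)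
    rw [sub_self, add_zero] at hlim
    refine ge_of_tendsto' hlim fun n => ?_
    obtain ⟨T, hT, hTt, hle⟩ := (h n).dom t ht S hS hSt
    have hsub : fstUnion (H n) ⊆ U := subset_iUnion (fun n => fstUnion (H n)) n
    have hsub' : sndUnion (H n) ⊆ V := subset_iUnion (fun n => sndUnion (H n)) n
    have h1 := hY.mass_le hy' hT hTt
    rw [mass_indicator_compl (h n).meas_snd, mass_indicator_compl (h n).meas_fst] at hle
    rw [mass_indicator_compl hU] at h1
    rw [mass_indicator_compl hV]
    have h2 : mass y (T \ fstUnion (H n)) ≤ mass y (T \ U) + mass y (U \ fstUnion (H n)) := by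
      rw [← hy.mass_union (disjoint_sdiff_left.mono_right sdiff_subset) (hU.diff (h n).meas_fst)]
      refine hy.mass_mono fun a ha => ?_
      by_cases haU : a ∈ U
      · exact Or.inr ⟨haU, ha.2⟩
      · exact Or.inl ⟨ha.1, haU⟩
    rw [hy.mass_sdiff (h n).meas_fst hsub] at h2
    have h3 := hx.mass_mono (sdiff_subset_sdiff_right (s := S) hsub')
    linarith

/-- A family whose used mass cannot grow under extension must have used all of it, by
`GoodFamily.extend`. -/
lemma exists_goodFamily_exhausting (h : Dom x y) (hx : Density x) (hy : Density y) :
    ∃ F, GoodFamily x y F ∧ mass x (sndUnion F)ᶜ = 0 := by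
  have hempty : GoodFamily x y ∅ := by
    refine ⟨countable_empty, by simp, pairwiseDisjoint_empty, pairwiseDisjoint_empty, ?_, ?_⟩
    · simp [fstUnion, sndUnion]
    · simpa [fstUnion, sndUnion] using h
  obtain ⟨⟨F, hF⟩, hmax⟩ := exists_forall_ge_le (α := {F // GoodFamily x y F}) ⟨∅, hempty⟩
    (fun F => mass x (sndUnion F.1))
    (fun (F G : {F // GoodFamily x y F}) hFG => hx.mass_mono (sndUnion_mono hFG))
    (mass x univ) (fun F => hx.mass_mono (subset_univ _))
    (fun u hu => ⟨(⟨⋃ n, (u n).1, GoodFamily.iUnion hx hy (fun i j hij => hu hij)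
      fun n => (u n).2⟩ : {F // GoodFamily x y F}), fun n => subset_iUnion (fun n => (u n).1) n⟩)
  refine ⟨F, hF, ?_⟩
  by_contra hne
  obtain ⟨G, hG, hFG, hlt⟩ := hF.extend hx hy (lt_of_le_of_ne (hx.mass_nonneg _) (Ne.symm hne))
  exact absurd (hmax ⟨G, hG⟩ hFG) (not_le.2 hlt)

lemma inter_support_indicator {f : HalfLine → ℝ} (hf : Density f) (S : Set HalfLine) :
    (S ∩ {a | 0 < f a}).indicator f = S.indicator f := by
  ext a
  by_cases hS : a ∈ S
  · by_cases ha : 0 < f a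
    · rw [indicator_of_mem hS, indicator_of_mem (mem_inter hS ha)]
    · rw [indicator_of_mem hS, indicator_of_notMem fun h' => ha h'.2]
      exact le_antisymm (hf.nonneg a) (not_lt.1 ha)
  · rw [indicator_of_notMem hS, indicator_of_notMem fun h' => hS h'.1]

lemma mass_inter_support {f : HalfLine → ℝ} (hf : Density f) (S : Set HalfLine) :
    mass f (S ∩ {a | 0 < f a}) = mass f S := by
  have h1 := hf.mass_inter_add_sdiff (S := S) (T := {a | 0 < f a})
    (measurableSet_lt measurable_const hf.measurable)
  have h2 : mass f (S \ {a | 0 < f a}) = 0 :=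
    setIntegral_eq_zero_of_forall_eq_zero fun a ha =>
      le_antisymm (not_lt.1 (show ¬ 0 < f a from ha.2)) (hf.nonneg a)
  linarith

/-- Restriction to supports makes the sets for the positive and the negative parts automatically
disjoint. -/
lemma GoodPair.inter_support {A B : Set HalfLine} (h : GoodPair x y A B) (hx : Density x)
    (hy : Density y) : GoodPair x y (A ∩ {a | 0 < y a}) (B ∩ {a | 0 < x a}) := by
  refine ⟨h.measA.inter (measurableSet_lt measurable_const hy.measurable),
    h.measB.inter (measurableSet_lt measurable_const hx.measurable),
    (measure_mono inter_subset_left).trans_lt h.finA,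
    (measure_mono inter_subset_left).trans_lt h.finB, ?_, ?_⟩
  · rw [mass_inter_support hx, mass_inter_support hy, h.mass_eq]
  · rw [inter_support_indicator hx, inter_support_indicator hy]
    exact h.dom

/-- A dominated density decomposes into countably many good pairs exhausting it. -/
lemma exists_goodPair_sequence (h : Dom x y) (hx : Density x) (hy : Density y) :
    ∃ A B : ℕ → Set HalfLine, (∀ n, GoodPair x y (A n) (B n)) ∧
      Pairwise (fun i j => Disjoint (A i) (A j)) ∧ Pairwise (fun i j => Disjoint (B i) (B j)) ∧
      (∀ n, A n ⊆ {a | 0 < y a}) ∧ (∀ n, B n ⊆ {a | 0 < x a}) ∧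
      mass x (⋃ n, B n)ᶜ = 0 ∧ mass y (⋃ n, A n) = mass x univ := by
  obtain ⟨F, hF, hF0⟩ := exists_goodFamily_exhausting h hx hy
  have := hF.countable.toEncodable
  -- `decode₂` gives each pair only one index, so disjointness survives the enumeration; unused
  -- indices carry the trivial pair.
  let p : ℕ → Set HalfLine × Set HalfLine := fun n =>
    (Encodable.decode₂ F n).elim (∅, ∅) Subtype.val
  have hp : ∀ n, p n = (∅, ∅) ∨ ∃ q : F, p n = q.1 ∧ Encodable.encode q = n := by
    intro n
    rcases hn : Encodable.decode₂ F n with _ | q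
    · left; simp only [p, hn]; rfl
    · right; exact ⟨q, by simp only [p, hn]; rfl, Encodable.mem_decode₂.1 hn⟩
  have hp' : ∀ q : F, p (Encodable.encode q) = q.1 := by
    intro q
    simp only [p, Encodable.encodek₂]; rfl
  have hgood : ∀ n, GoodPair x y (p n).1 (p n).2 := by
    intro n
    rcases hp n with hn | ⟨q, hq, -⟩
    · rw [hn]
      refine ⟨MeasurableSet.empty, MeasurableSet.empty, by simp, by simp, by simp, ?_⟩
      intro t _ S hS hSt
      exact ⟨S, hS, hSt, by simp [mass]⟩
    · rw [hq]; exact hF.good _ q.2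
  have hdA : Pairwise (fun i j => Disjoint (p i).1 (p j).1) := by
    intro i j hij
    rcases hp i with hi | ⟨q, hq, hqi⟩
    · rw [hi]; exact disjoint_bot_left
    rcases hp j with hj | ⟨q', hq', hqj⟩
    · rw [hj]; exact disjoint_bot_right
    rw [hq, hq']
    exact hF.disjA q.2 q'.2 fun heq => hij (by rw [← hqi, ← hqj, Subtype.ext heq])
  have hdB : Pairwise (fun i j => Disjoint (p i).2 (p j).2) := by
    intro i j hij
    rcases hp i with hi | ⟨q, hq, hqi⟩
    · rw [hi]; exact disjoint_bot_left
    rcases hp j with hj | ⟨q', hq', hqj⟩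
    · rw [hj]; exact disjoint_bot_right
    rw [hq, hq']
    exact hF.disjB q.2 q'.2 fun heq => hij (by rw [← hqi, ← hqj, Subtype.ext heq])
  have hUA : ⋃ n, (p n).1 = fstUnion F := by
    refine subset_antisymm (iUnion_subset fun n => ?_) (iUnion₂_subset fun q hq => ?_)
    · rcases hp n with hn | ⟨q, hq, -⟩
      · rw [hn]; exact empty_subset _
      · rw [hq]; exact subset_biUnion_of_mem (u := fun p => p.1) q.2
    · have := subset_iUnion (fun n => (p n).1) (Encodable.encode (⟨q, hq⟩ : F))
      simpa only [hp'] using this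
  have hUB : ⋃ n, (p n).2 = sndUnion F := by
    refine subset_antisymm (iUnion_subset fun n => ?_) (iUnion₂_subset fun q hq => ?_)
    · rcases hp n with hn | ⟨q, hq, -⟩
      · rw [hn]; exact empty_subset _
      · rw [hq]; exact subset_biUnion_of_mem (u := fun p => p.2) q.2
    · have := subset_iUnion (fun n => (p n).2) (Encodable.encode (⟨q, hq⟩ : F))
      simpa only [hp'] using this
  have hx0 : ∀ S, mass x S = mass x (S ∩ sndUnion F) + mass x (S \ sndUnion F) :=
    fun S => (hx.mass_inter_add_sdiff hF.meas_snd).symm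
  refine ⟨fun n => (p n).1 ∩ {a | 0 < y a}, fun n => (p n).2 ∩ {a | 0 < x a},
    fun n => (hgood n).inter_support hx hy,
    fun i j hij => (hdA hij).mono inter_subset_left inter_subset_left,
    fun i j hij => (hdB hij).mono inter_subset_left inter_subset_left,
    fun n => inter_subset_right, fun n => inter_subset_right, ?_, ?_⟩
  · rw [← iUnion_inter, hUB, compl_inter, ← mass_inter_support hx, union_inter_distrib_right,
      compl_inter_self, union_empty, mass_inter_support hx, hF0]
  · rw [← iUnion_inter, hUA, mass_inter_support hy, hF.mass_eq]
    have := hx.mass_inter_add_sdiff (S := univ) hF.meas_snd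
    rw [univ_inter, ← compl_eq_univ_sdiff, hF0, add_zero] at this
    exact this

end Family

/-! ### Almost everywhere equality and extension by zero -/

lemma rearrangement_congr {α : Type*} [MeasurableSpace α] {ν : Measure α} {f g : α → ℝ}
    (h : f =ᵐ[ν] g) : rearrangement ν f = rearrangement ν g := by
  have key : ∀ s : ℝ≥0∞, ν {a | s < ENNReal.ofReal |f a|} = ν {a | s < ENNReal.ofReal |g a|} := by
    intro s
    refine measure_congr ?_
    filter_upwards [h] with a ha
    refine propext ?_
    change s < ENNReal.ofReal |f a| ↔ s < ENNReal.ofReal |g a|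
    rw [ha]
  ext t
  simp only [rearrangement, key]

lemma Majorized.congr {α : Type*} [MeasurableSpace α] {ν : Measure α} {x y x' y' : α → ℝ}
    (h : Majorized ν x y) (hx : x =ᵐ[ν] x') (hy : y =ᵐ[ν] y') : Majorized ν x' y' := by
  have submaj : ∀ {u v u' v' : α → ℝ}, u =ᵐ[ν] u' → v =ᵐ[ν] v' → Submajorized ν u v →
      Submajorized ν u' v' := fun hu hv h => by
    rwa [Submajorized, ← rearrangement_congr hu, ← rearrangement_congr hv]
  refine ⟨h.integrable_left.congr hx, h.integrable_right.congr hy, ?_, ?_, ?_⟩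
  · exact submaj (hx.fun_comp fun r => max r 0) (hy.fun_comp fun r => max r 0) h.pos
  · exact submaj (hx.fun_comp fun r => max (-r) 0) (hy.fun_comp fun r => max (-r) 0) h.neg
  · rw [← integral_congr_ae hx, ← integral_congr_ae hy, h.integral_eq]

lemma measurableEmbedding_inl {α β : Type*} [MeasurableSpace α] [MeasurableSpace β] :
    MeasurableEmbedding (Sum.inl : α → α ⊕ β) :=
  ⟨Sum.inl_injective, measurable_inl, fun {_} => measurableSet_inl_image.2⟩

lemma measurableEmbedding_inr {α β : Type*} [MeasurableSpace α] [MeasurableSpace β] :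
    MeasurableEmbedding (Sum.inr : β → α ⊕ β) :=
  ⟨Sum.inr_injective, measurable_inr, fun {_} => measurableSet_inr_image.2⟩

lemma sumMeasure_apply (S : Set (HalfLine ⊕ HalfLine)) :
    sumMeasure S = halfLineMeasure (Sum.inl ⁻¹' S) + halfLineMeasure (Sum.inr ⁻¹' S) := by
  rw [sumMeasure, Measure.add_apply, measurableEmbedding_inl.map_apply,
    measurableEmbedding_inr.map_apply]

lemma sumMeasure_image_union (S T : Set HalfLine) :
    sumMeasure (Sum.inl '' S ∪ Sum.inr '' T) = halfLineMeasure S + halfLineMeasure T := by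
  rw [sumMeasure_apply]
  congr 2 <;> ext a <;> simp

/-- The second copy contributes nothing to a strict superlevel set, as the levels are nonnegative.
-/
lemma rearrangement_extendZero (f : HalfLine → ℝ) :
    rearrangement sumMeasure (extendZero f) = rearrangement halfLineMeasure f := by
  ext t
  simp only [rearrangement, sumMeasure_apply, preimage_ofPred_eq]
  simp [extendZero]

lemma integrable_extendZero {f : HalfLine → ℝ} (hf : Integrable f halfLineMeasure) :
    Integrable (extendZero f) sumMeasure := by
  rw [sumMeasure, integrable_add_measure, measurableEmbedding_inl.integrable_map_iff,
    measurableEmbedding_inr.integrable_map_iff]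
  exact ⟨hf, integrable_zero _ _ _⟩

lemma integral_extendZero {f : HalfLine → ℝ} (hf : Integrable f halfLineMeasure) :
    ∫ a, extendZero f a ∂sumMeasure = ∫ a, f a ∂halfLineMeasure := by
  have h := integrable_extendZero hf
  rw [sumMeasure, integrable_add_measure] at h
  rw [sumMeasure, integral_add_measure h.1 h.2, measurableEmbedding_inl.integral_map,
    measurableEmbedding_inr.integral_map]
  simp [extendZero]

lemma comp_extendZero (φ : ℝ → ℝ) (h : φ 0 = 0) (f : HalfLine → ℝ) :
    (fun a => φ (extendZero f a)) = extendZero fun a => φ (f a) := by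
  ext (a | a) <;> simp [extendZero, h]

lemma Majorized.extendZero {x y : HalfLine → ℝ} (h : Majorized halfLineMeasure x y) :
    Majorized sumMeasure (extendZero x) (extendZero y) := by
  refine ⟨integrable_extendZero h.integrable_left, integrable_extendZero h.integrable_right,
    ?_, ?_, ?_⟩
  · rw [Submajorized, comp_extendZero (fun r => max r 0) (by simp),
      comp_extendZero (fun r => max r 0) (by simp), rearrangement_extendZero,
      rearrangement_extendZero]
    exact h.pos
  · rw [Submajorized, comp_extendZero (fun r => max (-r) 0) (by simp),
      comp_extendZero (fun r => max (-r) 0) (by simp), rearrangement_extendZero,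
      rearrangement_extendZero]
    exact h.neg
  · rw [integral_extendZero h.integrable_left, integral_extendZero h.integrable_right,
      h.integral_eq]

lemma indicator_extendZero (f : HalfLine → ℝ) (S T : Set HalfLine) :
    (Sum.inl '' S ∪ Sum.inr '' T).indicator (extendZero f) = extendZero (S.indicator f) := by
  classical
  ext (a | a) <;> simp [extendZero, indicator_apply]

/-! ### Cutting by measure and by mass -/

/-- The half-line is a disjoint union of sets of prescribed measures `b n + 1`. -/
lemma exists_partition_measure_eq (b : ℕ → ℝ) (hb : ∀ n, 0 ≤ b n) :
    ∃ P : ℕ → Set HalfLine, (∀ n, MeasurableSet (P n)) ∧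
      Pairwise (fun i j => Disjoint (P i) (P j)) ∧ (⋃ n, P n) = univ ∧
      ∀ n, halfLineMeasure (P n) = ENNReal.ofReal (b n + 1) := by
  set σ : ℕ → ℝ := fun n => ∑ k ∈ Finset.range n, (b k + 1) with hσ
  have hsucc : ∀ n, σ (n + 1) = σ n + (b n + 1) := fun n => Finset.sum_range_succ _ _
  have hmono : Monotone σ := monotone_nat_of_le_succ fun n => by
    rw [hsucc]; linarith [hb n]
  -- The summand `1` makes the endpoints unbounded even when `b` is summable or zero.
  have hge : ∀ n : ℕ, (n : ℝ) ≤ σ n := by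
    intro n
    induction n with
    | zero => simp [hσ]
    | succ k ih => rw [hsucc]; push_cast; linarith [hb k]
  have h0 : σ 0 = 0 := by simp [hσ]
  have hU : Monotone fun n => below (σ (n + 1)) := fun i j hij =>
    below_mono (hmono (Nat.succ_le_succ hij))
  refine ⟨disjointed fun n => below (σ (n + 1)),
    fun n => MeasurableSet.disjointed (fun n => measurableSet_below _) n,
    disjoint_disjointed _, ?_, ?_⟩
  · rw [iUnion_disjointed, eq_univ_iff_forall]
    intro a
    obtain ⟨n, hn⟩ := exists_nat_gt a.1
    refine mem_iUnion.2 ⟨n, ?_⟩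
    change a.1 < σ (n + 1)
    linarith [hge n, hmono (Nat.le_succ n)]
  · rintro (_ | n)
    · rw [disjointed_zero, halfLineMeasure_below, hsucc, h0, zero_add]
    · rw [hU.disjointed_add_one, MeasureTheory.measure_sdiff (hU (Nat.le_succ n))
        (measurableSet_below _).nullMeasurableSet
        (by rw [halfLineMeasure_below]; exact ENNReal.ofReal_ne_top), halfLineMeasure_below,
        halfLineMeasure_below, ← ENNReal.ofReal_sub _ ((Nat.cast_nonneg _).trans (hge _)),
        hsucc (n + 1), add_sub_cancel_left]

/-- A density with positive total mass `c` is cut into pieces whose masses depend only on `c`. -/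
lemma Density.exists_cut {f : HalfLine → ℝ} (hf : Density f) (hpos : 0 < mass f univ) :
    ∃ S : ℕ → Set HalfLine, (∀ n, MeasurableSet (S n)) ∧
      Pairwise (fun i j => Disjoint (S i) (S j)) ∧ (∀ n, halfLineMeasure (S n) < ∞) ∧
      mass f (⋃ n, S n)ᶜ = 0 ∧
      mass f (S 0) = 0 ∧ ∀ n : ℕ, mass f (S (n + 1)) =
        mass f univ * (1 - (1 / 2) ^ (n + 1)) - mass f univ * (1 - (1 / 2) ^ n) := by
  set c := mass f univ
  have hlt : ∀ n : ℕ, c * (1 - (1 / 2) ^ n) < c := fun n => by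
    have : (0 : ℝ) < (1 / 2) ^ n := by positivity
    nlinarith
  have hnn : ∀ n : ℕ, 0 ≤ c * (1 - (1 / 2 : ℝ) ^ n) := fun n =>
    mul_nonneg hpos.le (sub_nonneg.2 (pow_le_one₀ (by norm_num) (by norm_num)))
  have hstr : StrictMono fun n : ℕ => c * (1 - (1 / 2 : ℝ) ^ n) :=
    strictMono_nat_of_lt_succ fun n => by
      have : (0 : ℝ) < (1 / 2) ^ n := by positivity
      rw [pow_succ]
      nlinarith
  set ν := halfLineMeasure.withDensity fun a => ENNReal.ofReal (f a)
  have hν : ∀ S, MeasurableSet S → ν S = ENNReal.ofReal (mass f S) := fun S hS => by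
    rw [hf.ofReal_mass, withDensity_apply _ hS]
  -- The levels `c * (1 - (1 / 2) ^ n)` stay strictly below the total mass, so each is reached at a
  -- finite point, and the pieces have finite measure.
  have key : ∀ n : ℕ, ∃ q, mass f (below q) = c * (1 - (1 / 2) ^ n) := by
    intro n
    obtain ⟨q, hq⟩ := exists_measure_below_eq ν
      (fun a => withDensity_absolutelyContinuous _ _ (halfLineMeasure_singleton a))
      (fun q => by rw [hν _ (measurableSet_below q)]; exact ENNReal.ofReal_ne_top)
      (c := ENNReal.ofReal (c * (1 - (1 / 2) ^ n))) (by
        rw [hν _ MeasurableSet.univ]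
        exact (ENNReal.ofReal_lt_ofReal_iff hpos).2 (hlt n))
    refine ⟨q, ?_⟩
    rwa [hν _ (measurableSet_below q),
      ENNReal.ofReal_eq_ofReal_iff (hf.mass_nonneg _) (hnn n)] at hq
  choose q hq using key
  have hqle : ∀ n, q n ≤ q (n + 1) := fun n => le_of_not_ge fun h => by
    have := hf.mass_mono (below_mono h)
    rw [hq, hq] at this
    exact absurd this (not_le.2 (hstr n.lt_succ_self))
  have hqm : Monotone fun n => below (q n) := below_mono.comp (monotone_nat_of_le_succ hqle)
  refine ⟨disjointed fun n => below (q n),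
    fun n => MeasurableSet.disjointed (fun n => measurableSet_below _) n,
    disjoint_disjointed _, fun n => ?_, ?_, ?_, fun n => ?_⟩
  · refine (measure_mono (disjointed_subset _ n)).trans_lt ?_
    rw [halfLineMeasure_below]; exact ENNReal.ofReal_lt_top
  · rw [iUnion_disjointed]
    have h1 := hf.tendsto_mass_iUnion (fun n => measurableSet_below (q n)) hqm
    have h2 : Tendsto (fun n : ℕ => c * (1 - (1 / 2 : ℝ) ^ n)) atTop (𝓝 (c * (1 - 0))) :=
      tendsto_const_nhds.mul (tendsto_const_nhds.sub
        (tendsto_pow_atTop_nhds_zero_of_lt_one (by norm_num) (by norm_num)))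
    have h3 := tendsto_nhds_unique (by simpa only [hq] using h1) h2
    have h4 := hf.mass_sdiff (S := univ)
      (MeasurableSet.iUnion fun n => measurableSet_below (q n)) (subset_univ _)
    rw [compl_eq_univ_sdiff, h4, h3]
    simp [c]
  · rw [disjointed_zero, hq]; simp
  · rw [hqm.disjointed_add_one, hf.mass_sdiff (measurableSet_below _) (below_mono (hqle n)), hq, hq]

/-- Two densities of equal total mass can be cut into pieces of equal masses. -/
lemma exists_cut_pair {f g : HalfLine → ℝ} (hf : Density f) (hg : Density g)
    (h : mass f univ = mass g univ) :
    ∃ S T : ℕ → Set HalfLine, (∀ n, MeasurableSet (S n)) ∧ (∀ n, MeasurableSet (T n)) ∧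
      Pairwise (fun i j => Disjoint (S i) (S j)) ∧ Pairwise (fun i j => Disjoint (T i) (T j)) ∧
      (∀ n, halfLineMeasure (S n) < ∞) ∧ (∀ n, halfLineMeasure (T n) < ∞) ∧
      mass f (⋃ n, S n)ᶜ = 0 ∧ mass g (⋃ n, T n)ᶜ = 0 ∧ ∀ n, mass f (S n) = mass g (T n) := by
  rcases (hf.mass_nonneg univ).eq_or_lt with h0 | hpos
  · have hg0 : mass g univ = 0 := by rw [← h, ← h0]
    exact ⟨fun _ => ∅, fun _ => ∅, by simp, by simp, fun _ _ _ => disjoint_bot_left,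
      fun _ _ _ => disjoint_bot_left, by simp, by simp, by simp [← h0], by simp [hg0], by simp⟩
  · obtain ⟨S, hS, hSd, hSf, hS0, hS1, hS2⟩ := hf.exists_cut hpos
    obtain ⟨T, hT, hTd, hTf, hT0, hT1, hT2⟩ := hg.exists_cut (h ▸ hpos)
    refine ⟨S, T, hS, hT, hSd, hTd, hSf, hTf, hS0, hT0, ?_⟩
    rintro (_ | n)
    · rw [hS1, hT1]
    · rw [hS2, hT2, h]

/-! ### Signed functions on the half-line -/

lemma Density.dom_of_mass_eq_zero {x y : HalfLine → ℝ} (hx : Density x)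
    (h : mass x univ = 0) : Dom x y := by
  intro t _ S hS hSt
  refine ⟨∅, MeasurableSet.empty, by simp, ?_⟩
  rw [mass_empty, ← h]
  exact hx.mass_mono (subset_univ _)

/-- The positive part of a function. -/
def posPart (f : HalfLine → ℝ) : HalfLine → ℝ := fun a => max (f a) 0

/-- The negative part of a function. -/
def negPart (f : HalfLine → ℝ) : HalfLine → ℝ := fun a => max (-f a) 0

section Signed

variable {x y : HalfLine → ℝ}

lemma density_posPart (hm : Measurable x) (hx : Integrable x halfLineMeasure) :
    Density (posPart x) :=
  ⟨hm.max measurable_const, fun _ => le_max_right _ _, hx.pos_part⟩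

lemma density_negPart (hm : Measurable x) (hx : Integrable x halfLineMeasure) :
    Density (negPart x) :=
  ⟨hm.neg.max measurable_const, fun _ => le_max_right _ _, hx.neg_part⟩

lemma mass_posPart_sub_negPart (hm : Measurable x) (hx : Integrable x halfLineMeasure)
    (S : Set HalfLine) : mass (posPart x) S - mass (negPart x) S = mass x S := by
  rw [mass, mass, ← integral_sub (density_posPart hm hx).integrable.integrableOn
    (density_negPart hm hx).integrable.integrableOn]
  exact integral_congr_ae (ae_of_all _ fun a => max_zero_sub_max_neg_zero_eq_self (x a))

lemma max_indicator (S : Set HalfLine) (f : HalfLine → ℝ) :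
    (fun a => max (S.indicator f a) 0) = S.indicator (posPart f) := by
  classical
  ext a
  by_cases h : a ∈ S <;> simp [h, posPart]

lemma max_neg_indicator (S : Set HalfLine) (f : HalfLine → ℝ) :
    (fun a => max (-S.indicator f a) 0) = S.indicator (negPart f) := by
  classical
  ext a
  by_cases h : a ∈ S <;> simp [h, negPart]

lemma majorized_indicator (hxm : Measurable x) (hx : Integrable x halfLineMeasure)
    (hym : Measurable y) (hy : Integrable y halfLineMeasure) {A B : Set HalfLine}
    (hA : MeasurableSet A) (hB : MeasurableSet B)
    (hpos : Dom (B.indicator (posPart x)) (A.indicator (posPart y)))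
    (hneg : Dom (B.indicator (negPart x)) (A.indicator (negPart y)))
    (h : mass (posPart x) B - mass (negPart x) B = mass (posPart y) A - mass (negPart y) A) :
    Majorized halfLineMeasure (B.indicator x) (A.indicator y) := by
  refine ⟨hx.indicator hB, hy.indicator hA, ?_, ?_, ?_⟩
  · rw [max_indicator, max_indicator]
    exact (dom_iff_submajorized ((density_posPart hxm hx).indicator hB)
      ((density_posPart hym hy).indicator hA)).1 hpos
  · rw [max_neg_indicator, max_neg_indicator]
    exact (dom_iff_submajorized ((density_negPart hxm hx).indicator hB)
      ((density_negPart hym hy).indicator hA)).1 hneg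
  · rw [integral_indicator hA, integral_indicator hB]
    rwa [mass_posPart_sub_negPart hxm hx, mass_posPart_sub_negPart hym hy] at h

end Signed

lemma pairwise_disjoint_sumElim {ι κ α : Type*} {u : ι → Set α} {v : κ → Set α}
    (hu : Pairwise fun i j => Disjoint (u i) (u j)) (hv : Pairwise fun i j => Disjoint (v i) (v j))
    (huv : ∀ i j, Disjoint (u i) (v j)) :
    Pairwise fun i j => Disjoint (Sum.elim u v i) (Sum.elim u v j) := by
  rintro (i | i) (j | j) hij
  · exact hu fun h => hij (congrArg _ h)
  · exact huv i j
  · exact (huv j i).symm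
  · exact hv fun h => hij (congrArg _ h)

/-- The decomposition on the half-line, without equality of measures. -/
lemma exists_majorized_partition {x y : HalfLine → ℝ} (hxm : Measurable x) (hym : Measurable y)
    (h : Majorized halfLineMeasure x y) :
    ∃ A B : ℕ → Set HalfLine, (∀ n, MeasurableSet (A n)) ∧ (∀ n, MeasurableSet (B n)) ∧
      Pairwise (fun i j => Disjoint (A i) (A j)) ∧ Pairwise (fun i j => Disjoint (B i) (B j)) ∧
      (⋃ n, A n) = univ ∧ (⋃ n, B n) = univ ∧
      (∀ n, halfLineMeasure (A n) < ∞) ∧ (∀ n, halfLineMeasure (B n) < ∞) ∧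
      ∀ n, Majorized halfLineMeasure ((B n).indicator x) ((A n).indicator y) := by
  have hx := h.integrable_left
  have hy := h.integrable_right
  have hxp := density_posPart hxm hx
  have hxn := density_negPart hxm hx
  have hyp := density_posPart hym hy
  have hyn := density_negPart hym hy
  obtain ⟨Ap, Bp, hp, hApd, hBpd, hAps, hBps, hBp0, hApm⟩ :=
    exists_goodPair_sequence ((dom_iff_submajorized hxp hyp).2 h.pos) hxp hyp
  obtain ⟨An, Bn, hn, hAnd, hBnd, hAns, hBns, hBn0, hAnm⟩ :=
    exists_goodPair_sequence ((dom_iff_submajorized hxn hyn).2 h.neg) hxn hyn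
  have sgn : ∀ (z : HalfLine → ℝ) (S T : Set HalfLine), S ⊆ {a | 0 < posPart z a} →
      T ⊆ {a | 0 < negPart z a} → Disjoint S T := by
    intro z S T hS hT
    refine Set.disjoint_left.2 fun a ha ha' => ?_
    have h1 : 0 < max (z a) 0 := hS ha
    have h2 : 0 < max (-z a) 0 := hT ha'
    simp only [lt_max_iff, lt_irrefl, or_false] at h1 h2
    linarith
  have zero_neg : ∀ (z : HalfLine → ℝ) (S : Set HalfLine), S ⊆ {a | 0 < posPart z a} →
      mass (negPart z) S = 0 := by
    intro z S hS
    refine setIntegral_eq_zero_of_forall_eq_zero fun a ha => ?_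
    have h1 : 0 < max (z a) 0 := hS ha
    simp only [lt_max_iff, lt_irrefl, or_false] at h1
    exact max_eq_right (by linarith)
  have zero_pos : ∀ (z : HalfLine → ℝ) (S : Set HalfLine), S ⊆ {a | 0 < negPart z a} →
      mass (posPart z) S = 0 := by
    intro z S hS
    refine setIntegral_eq_zero_of_forall_eq_zero fun a ha => ?_
    have h1 : 0 < max (-z a) 0 := hS ha
    simp only [lt_max_iff, lt_irrefl, or_false] at h1
    exact max_eq_right (by linarith)
  have hApU : MeasurableSet (⋃ n, Ap n) := MeasurableSet.iUnion fun n => (hp n).measA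
  have hAnU : MeasurableSet (⋃ n, An n) := MeasurableSet.iUnion fun n => (hn n).measA
  -- what remains of `y`
  set P : Set HalfLine := {a | 0 < posPart y a} \ ⋃ n, Ap n with hPdef
  set N : Set HalfLine := {a | 0 < negPart y a} \ ⋃ n, An n with hNdef
  have hP : MeasurableSet P := (measurableSet_lt measurable_const hyp.measurable).diff hApU
  have hN : MeasurableSet N := (measurableSet_lt measurable_const hyn.measurable).diff hAnU
  have hPm : mass (posPart y) P = mass (posPart y) univ - mass (posPart x) univ := by
    have h1 := hyp.mass_inter_add_sdiff (S := univ) hApU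
    have h2 := mass_inter_support hyp (univ \ ⋃ n, Ap n)
    have h3 : (univ \ ⋃ n, Ap n) ∩ {a | 0 < posPart y a} = P := by
      rw [← compl_eq_univ_sdiff, inter_comm, hPdef, sdiff_eq]
    rw [h3] at h2
    rw [univ_inter, hApm] at h1
    linarith
  have hNm : mass (negPart y) N = mass (negPart y) univ - mass (negPart x) univ := by
    have h1 := hyn.mass_inter_add_sdiff (S := univ) hAnU
    have h2 := mass_inter_support hyn (univ \ ⋃ n, An n)
    have h3 : (univ \ ⋃ n, An n) ∩ {a | 0 < negPart y a} = N := by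
      rw [← compl_eq_univ_sdiff, inter_comm, hNdef, sdiff_eq]
    rw [h3] at h2
    rw [univ_inter, hAnm] at h1
    linarith
  -- The equality `∫ x = ∫ y` enters here: it says that the excesses of `y₊` over `x₊` and of `y₋`
  -- over `x₋` are the same.
  have hPN : mass (P.indicator (posPart y)) univ = mass (N.indicator (negPart y)) univ := by
    rw [mass_indicator hP, mass_indicator hN, univ_inter, univ_inter, hPm, hNm]
    have h1 := mass_posPart_sub_negPart hxm hx univ
    have h2 := mass_posPart_sub_negPart hym hy univ
    have h3 : mass x univ = mass y univ := by
      rw [mass, mass, Measure.restrict_univ]; exact h.integral_eq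
    linarith
  obtain ⟨S, T, hS, hT, hSd, hTd, hSf, hTf, hS0, hT0, hST⟩ :=
    exists_cut_pair (hyp.indicator hP) (hyn.indicator hN) hPN
  simp only [mass_indicator hP, mass_indicator hN] at hS0 hT0 hST
  -- The integral of `y` over each of these sets is zero, so the zero function is majorized by `y`
  -- there; the partner is the empty set.
  set C : ℕ → Set HalfLine := fun n => S n ∩ P ∪ T n ∩ N with hC
  have hCm : ∀ n, MeasurableSet (C n) := fun n => ((hS n).inter hP).union ((hT n).inter hN)
  have hPs : P ⊆ {a | 0 < posPart y a} := sdiff_subset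
  have hNs : N ⊆ {a | 0 < negPart y a} := sdiff_subset
  have hPNd : Disjoint P N := sgn y P N hPs hNs
  have hCd : Pairwise fun i j => Disjoint (C i) (C j) := by
    intro i j hij
    refine Disjoint.union_left (Disjoint.union_right ?_ ?_) (Disjoint.union_right ?_ ?_)
    · exact (hSd hij).mono inter_subset_left inter_subset_left
    · exact hPNd.mono inter_subset_right inter_subset_right
    · exact hPNd.symm.mono inter_subset_right inter_subset_right
    · exact (hTd hij).mono inter_subset_left inter_subset_left
  have hCp : ∀ n, mass (posPart y) (C n) = mass (posPart y) (S n ∩ P) := by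
    intro n
    rw [hyp.mass_union (hPNd.mono inter_subset_right inter_subset_right) ((hT n).inter hN),
      zero_pos y (T n ∩ N) (inter_subset_right.trans hNs), add_zero]
  have hCn : ∀ n, mass (negPart y) (C n) = mass (negPart y) (T n ∩ N) := by
    intro n
    rw [hyn.mass_union (hPNd.mono inter_subset_right inter_subset_right) ((hT n).inter hN),
      zero_neg y (S n ∩ P) (inter_subset_right.trans hPs), zero_add]
  have hCU : MeasurableSet (⋃ n, C n) := MeasurableSet.iUnion hCm
  -- Pieces of measure `1`, which cut the leftover sets `ZA` and `ZB` into parts of finite measure.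
  obtain ⟨R, hR, hRd, hRU, hRm⟩ := exists_partition_measure_eq (fun _ => 0) fun _ => le_rfl
  set ZA : Set HalfLine := ((⋃ n, Ap n) ∪ (⋃ n, An n) ∪ ⋃ n, C n)ᶜ with hZA
  set ZB : Set HalfLine := ((⋃ n, Bp n) ∪ (⋃ n, Bn n))ᶜ with hZB
  have hZAm : MeasurableSet ZA := ((hApU.union hAnU).union hCU).compl
  have hZBm : MeasurableSet ZB := ((MeasurableSet.iUnion fun n => (hp n).measB).union
    (MeasurableSet.iUnion fun n => (hn n).measB)).compl
  have hZAp : mass (posPart y) ZA = 0 := by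
    refine le_antisymm ?_ (hyp.mass_nonneg _)
    rw [← mass_inter_support hyp]
    refine (hyp.mass_mono (T := (⋃ n, S n)ᶜ ∩ P) ?_).trans hS0.le
    intro a ha
    have haZ : a ∉ (⋃ n, Ap n) ∪ (⋃ n, An n) ∪ ⋃ n, C n := ha.1
    simp only [mem_union, not_or] at haZ
    have haP : a ∈ P := ⟨ha.2, haZ.1.1⟩
    refine ⟨fun haS => haZ.2 ?_, haP⟩
    obtain ⟨n, hn⟩ := mem_iUnion.1 haS
    exact mem_iUnion.2 ⟨n, Or.inl ⟨hn, haP⟩⟩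
  have hZAn : mass (negPart y) ZA = 0 := by
    refine le_antisymm ?_ (hyn.mass_nonneg _)
    rw [← mass_inter_support hyn]
    refine (hyn.mass_mono (T := (⋃ n, T n)ᶜ ∩ N) ?_).trans hT0.le
    intro a ha
    have haZ : a ∉ (⋃ n, Ap n) ∪ (⋃ n, An n) ∪ ⋃ n, C n := ha.1
    simp only [mem_union, not_or] at haZ
    have haN : a ∈ N := ⟨ha.2, haZ.1.2⟩
    refine ⟨fun haT => haZ.2 ?_, haN⟩
    obtain ⟨n, hn⟩ := mem_iUnion.1 haT
    exact mem_iUnion.2 ⟨n, Or.inr ⟨hn, haN⟩⟩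
  have hZBp : mass (posPart x) ZB = 0 :=
    le_antisymm ((hxp.mass_mono (compl_subset_compl.2 subset_union_left)).trans hBp0.le)
      (hxp.mass_nonneg _)
  have hZBn : mass (negPart x) ZB = 0 :=
    le_antisymm ((hxn.mass_mono (compl_subset_compl.2 subset_union_right)).trans hBn0.le)
      (hxn.mass_nonneg _)
  have sub0 : ∀ {z : HalfLine → ℝ} (_ : Density z) {Z : Set HalfLine} (_ : mass z Z = 0)
      (n : ℕ), mass z (Z ∩ R n) = 0 := fun hz _ hZ n =>
    le_antisymm ((hz.mass_mono inter_subset_left).trans hZ.le) (hz.mass_nonneg _)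
  have dom0 : ∀ {z w : HalfLine → ℝ} (_ : Density z) {B A : Set HalfLine} (_ : MeasurableSet B)
      (_ : mass z B = 0), Dom (B.indicator z) (A.indicator w) := fun hz _ _ hB h0 =>
    (hz.indicator hB).dom_of_mass_eq_zero (by rw [mass_indicator hB, univ_inter, h0])
  -- the families
  let A : (ℕ ⊕ ℕ) ⊕ (ℕ ⊕ ℕ) → Set HalfLine :=
    Sum.elim (Sum.elim Ap An) (Sum.elim C fun n => ZA ∩ R n)
  let B : (ℕ ⊕ ℕ) ⊕ (ℕ ⊕ ℕ) → Set HalfLine :=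
    Sum.elim (Sum.elim Bp Bn) (Sum.elim (fun _ => ∅) fun n => ZB ∩ R n)
  have hRf : ∀ Z n, halfLineMeasure (Z ∩ R n) < ∞ := fun Z n =>
    (measure_mono inter_subset_right).trans_lt (by rw [hRm]; exact ENNReal.ofReal_lt_top)
  have hRd' : ∀ Z, Pairwise fun i j => Disjoint (Z ∩ R i) (Z ∩ R j) := fun Z i j hij =>
    (hRd hij).mono inter_subset_right inter_subset_right
  have hAm : ∀ i, MeasurableSet (A i) := by
    rintro ((n | n) | (n | n))
    exacts [(hp n).measA, (hn n).measA, hCm n, hZAm.inter (hR n)]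
  have hBm : ∀ i, MeasurableSet (B i) := by
    rintro ((n | n) | (n | n))
    exacts [(hp n).measB, (hn n).measB, MeasurableSet.empty, hZBm.inter (hR n)]
  have hAd : Pairwise fun i j => Disjoint (A i) (A j) := by
    refine pairwise_disjoint_sumElim (pairwise_disjoint_sumElim hApd hAnd
      fun i j => sgn y _ _ (hAps i) (hAns j)) (pairwise_disjoint_sumElim hCd (hRd' ZA) ?_) ?_
    · intro i j
      refine Set.disjoint_left.2 fun a ha ha' => ha'.1 (Or.inr (mem_iUnion.2 ⟨i, ha⟩))
    · rintro (i | i) (j | j)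
      · refine Disjoint.union_right ?_ ?_
        · exact Set.disjoint_left.2 fun a ha ha' => ha'.2.2 (mem_iUnion.2 ⟨i, ha⟩)
        · exact sgn y _ _ (hAps i) (inter_subset_right.trans hNs)
      · exact Set.disjoint_left.2 fun a ha ha' =>
          ha'.1 (Or.inl (Or.inl (mem_iUnion.2 ⟨i, ha⟩)))
      · refine Disjoint.union_right ?_ ?_
        · exact (sgn y _ _ (inter_subset_right.trans hPs) (hAns i)).symm
        · exact Set.disjoint_left.2 fun a ha ha' => ha'.2.2 (mem_iUnion.2 ⟨i, ha⟩)
      · exact Set.disjoint_left.2 fun a ha ha' =>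
          ha'.1 (Or.inl (Or.inr (mem_iUnion.2 ⟨i, ha⟩)))
  have hBd : Pairwise fun i j => Disjoint (B i) (B j) := by
    refine pairwise_disjoint_sumElim (pairwise_disjoint_sumElim hBpd hBnd
      fun i j => sgn x _ _ (hBps i) (hBns j)) (pairwise_disjoint_sumElim
      (fun _ _ _ => disjoint_bot_left) (hRd' ZB) fun _ _ => disjoint_bot_left) ?_
    rintro (i | i) (j | j)
    · exact disjoint_bot_right
    · exact Set.disjoint_left.2 fun a ha ha' => ha'.1 (Or.inl (mem_iUnion.2 ⟨i, ha⟩))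
    · exact disjoint_bot_right
    · exact Set.disjoint_left.2 fun a ha ha' => ha'.1 (Or.inr (mem_iUnion.2 ⟨i, ha⟩))
  have hAU : (⋃ i, A i) = univ := by
    simp only [A, iUnion_sumElim, ← inter_iUnion, hRU, inter_univ]
    rw [← union_assoc, hZA, union_compl_self]
  have hBU : (⋃ i, B i) = univ := by
    simp only [B, iUnion_sumElim, ← inter_iUnion, hRU, inter_univ, iUnion_empty, empty_union]
    rw [hZB, union_compl_self]
  have hAf : ∀ i, halfLineMeasure (A i) < ∞ := by
    rintro ((n | n) | (n | n))
    · exact (hp n).finA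
    · exact (hn n).finA
    · exact (measure_union_le _ _).trans_lt (ENNReal.add_lt_top.2
        ⟨(measure_mono inter_subset_left).trans_lt (hSf n),
          (measure_mono inter_subset_left).trans_lt (hTf n)⟩)
    · exact hRf _ n
  have hBf : ∀ i, halfLineMeasure (B i) < ∞ := by
    rintro ((n | n) | (n | n))
    · exact (hp n).finB
    · exact (hn n).finB
    · change halfLineMeasure ∅ < ∞
      simp
    · exact hRf _ n
  have hmaj : ∀ i, Majorized halfLineMeasure ((B i).indicator x) ((A i).indicator y) := by
    intro i
    refine majorized_indicator hxm hx hym hy (hAm i) (hBm i) ?_ ?_ ?_ <;>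
      rcases i with ((n | n) | (n | n)) <;> simp only [A, B, Sum.elim_inl, Sum.elim_inr]
    · exact (hp n).dom
    · exact dom0 hxp (hn n).measB (zero_pos x _ (hBns n))
    · exact dom0 hxp MeasurableSet.empty (mass_empty _)
    · exact dom0 hxp (hZBm.inter (hR n)) (sub0 hxp hZBp n)
    · exact dom0 hxn (hp n).measB (zero_neg x _ (hBps n))
    · exact (hn n).dom
    · exact dom0 hxn MeasurableSet.empty (mass_empty _)
    · exact dom0 hxn (hZBm.inter (hR n)) (sub0 hxn hZBn n)
    · rw [zero_neg x _ (hBps n), zero_neg y _ (hAps n), (hp n).mass_eq]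
    · rw [zero_pos x _ (hBns n), zero_pos y _ (hAns n), (hn n).mass_eq]
    · rw [hCp, hCn, hST, mass_empty, mass_empty, sub_self, sub_self]
    · rw [sub0 hxp hZBp, sub0 hxn hZBn, sub0 hyp hZAp, sub0 hyn hZAn]
  let e : ℕ ≃ (ℕ ⊕ ℕ) ⊕ (ℕ ⊕ ℕ) := (Denumerable.eqv _).symm
  exact ⟨fun n => A (e n), fun n => B (e n), fun n => hAm _, fun n => hBm _,
    fun i j hij => hAd (e.injective.ne hij), fun i j hij => hBd (e.injective.ne hij),
    (e.surjective.iUnion_comp A).trans hAU, (e.surjective.iUnion_comp B).trans hBU,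
    fun n => hAf _, fun n => hBf _, fun n => hmaj _⟩

/-! ### Equalizing the measures on the second copy -/

lemma pairwise_disjoint_image_union {A P : ℕ → Set HalfLine}
    (hA : Pairwise fun i j => Disjoint (A i) (A j)) (hP : Pairwise fun i j => Disjoint (P i) (P j)) :
    Pairwise fun i j => Disjoint (Sum.inl '' A i ∪ Sum.inr '' P i : Set (HalfLine ⊕ HalfLine))
      (Sum.inl '' A j ∪ Sum.inr '' P j) := by
  intro i j hij
  rw [Set.disjoint_left]
  rintro (a | a) ha ha'
  · exact Set.disjoint_left.1 (hA hij) (by simpa using ha) (by simpa using ha')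
  · exact Set.disjoint_left.1 (hP hij) (by simpa using ha) (by simpa using ha')

lemma iUnion_image_union {A P : ℕ → Set HalfLine} (hA : ⋃ n, A n = univ) (hP : ⋃ n, P n = univ) :
    ⋃ n, (Sum.inl '' A n ∪ Sum.inr '' P n : Set (HalfLine ⊕ HalfLine)) = univ := by
  rw [iUnion_union_distrib, ← image_iUnion, ← image_iUnion, hA, hP, image_univ, image_univ,
    range_inl_union_range_inr]

lemma measurableSet_image_union {A P : Set HalfLine} (hA : MeasurableSet A)
    (hP : MeasurableSet P) :
    MeasurableSet (Sum.inl '' A ∪ Sum.inr '' P : Set (HalfLine ⊕ HalfLine)) :=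
  (measurableEmbedding_inl.measurableSet_image.2 hA).union
    (measurableEmbedding_inr.measurableSet_image.2 hP)

end HLP

theorem mainTheorem9 (x y : HLP.HalfLine → ℝ)
    (hxy : HLP.Majorized HLP.halfLineMeasure x y) :
    ∃ A B : ℕ → Set (HLP.HalfLine ⊕ HLP.HalfLine),
      (∀ n, MeasurableSet (A n)) ∧ (∀ n, MeasurableSet (B n)) ∧
      Pairwise (fun i j => Disjoint (A i) (A j)) ∧
      Pairwise (fun i j => Disjoint (B i) (B j)) ∧
      (⋃ n, A n) = Set.univ ∧ (⋃ n, B n) = Set.univ ∧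
      (∀ n, HLP.sumMeasure (A n) = HLP.sumMeasure (B n) ∧ HLP.sumMeasure (A n) < ∞) ∧
      ∀ n, HLP.Majorized HLP.sumMeasure
        ((B n).indicator (HLP.extendZero x)) ((A n).indicator (HLP.extendZero y)) := by
  have hx := hxy.integrable_left.aestronglyMeasurable
  have hy := hxy.integrable_right.aestronglyMeasurable
  -- Integrable functions are only almost everywhere measurable, so the partition is built for
  -- measurable representatives.
  obtain ⟨A, B, hA, hB, hAd, hBd, hAU, hBU, hAf, hBf, hmaj⟩ := HLP.exists_majorized_partition
    hx.stronglyMeasurable_mk.measurable hy.stronglyMeasurable_mk.measurable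
    (hxy.congr hx.ae_eq_mk hy.ae_eq_mk)
  -- `A n` receives a piece of measure `m(B n) + 1` and `B n` one of measure `m(A n) + 1`; both
  -- totals are `m(A n) + m(B n) + 1`.
  obtain ⟨P, hP, hPd, hPU, hPm⟩ := HLP.exists_partition_measure_eq
    (fun n => (HLP.halfLineMeasure (B n)).toReal) fun _ => ENNReal.toReal_nonneg
  obtain ⟨Q, hQ, hQd, hQU, hQm⟩ := HLP.exists_partition_measure_eq
    (fun n => (HLP.halfLineMeasure (A n)).toReal) fun _ => ENNReal.toReal_nonneg
  refine ⟨fun n => Sum.inl '' A n ∪ Sum.inr '' P n, fun n => Sum.inl '' B n ∪ Sum.inr '' Q n,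
    fun n => HLP.measurableSet_image_union (hA n) (hP n),
    fun n => HLP.measurableSet_image_union (hB n) (hQ n),
    HLP.pairwise_disjoint_image_union hAd hPd, HLP.pairwise_disjoint_image_union hBd hQd,
    HLP.iUnion_image_union hAU hPU, HLP.iUnion_image_union hBU hQU, fun n => ⟨?_, ?_⟩, fun n => ?_⟩
  · rw [HLP.sumMeasure_image_union, HLP.sumMeasure_image_union, hPm, hQm,
      ENNReal.ofReal_add ENNReal.toReal_nonneg zero_le_one,
      ENNReal.ofReal_add ENNReal.toReal_nonneg zero_le_one,
      ENNReal.ofReal_toReal (hAf n).ne, ENNReal.ofReal_toReal (hBf n).ne]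
    ring
  · rw [HLP.sumMeasure_image_union, hPm]
    exact ENNReal.add_lt_top.2 ⟨hAf n, ENNReal.ofReal_lt_top⟩
  · rw [HLP.indicator_extendZero, HLP.indicator_extendZero]
    refine ((hmaj n).congr ?_ ?_).extendZero
    · filter_upwards [hx.ae_eq_mk] with a ha
      by_cases h : a ∈ B n <;> simp [h, ha]
    · filter_upwards [hy.ae_eq_mk] with a ha
      by_cases h : a ∈ A n <;> simp [h, ha]
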